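/- **Setting.** Let $d\ge 2$ and consider panels $\boldsymbol Y=\sum_{k=1}^K\boldsymbol X_k\beta^0_k+\boldsymbol{\mathcal A}+\boldsymbol\varepsilon\in\mathbb R^{N_1\times\dots\times N_d}$ with $N_n\to\infty$ for every $n$ and $K$, $\beta^0$, $L$ fixed, where $\boldsymbol{\mathcal A}=\sum_{\ell=1}^L\varphi_{\ell}^{(1)}\circ\dots\circ\varphi_{\ell}^{(d)}$. For each $n$ the $N_n\times L$ matrix with columns $\varphi_{\ell}^{(n)}$ equals $\varphi^{(n)}B_n$, with an $N_n\times r_n$ (possibly random) factor matrix $\varphi^{(n)}$ with rows $\varphi^{(n)}_{i_n}\in\mathbb R^{r_n}$, and a fixed $r_n\times L$ matrix $B_n$ ($B_n=I$ when $r_n=L$). Write $N=\prod_nN_n$, $N_{-n}=\prod_{n'\ne n}N_{n'}$, $T_{(n)}\in\mathbb R^{N_n\times N_{-n}}$ for the flattening of a tensor $T$ in dimension $n$, $\|\cdot\|_F$ for the Frobenius norm and $\|\cdot\|$ for the Euclidean norm of a vector and the spectral norm of a matrix. "wpa1" means with probability approaching one. The integers $r_n\le\widehat r_n$ are fixed.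 **Conditions for the slope estimates**, for all $n$ and $k$: (a) $\|\boldsymbol X_k\|_F=O_p(\sqrt N)$ and $\|\boldsymbol\varepsilon_{(n)}\|=O_p(\max\{\sqrt{N_n},\sqrt{N_{-n}}\})$; (b) $\mathrm{vec}(\boldsymbol X_k)'\mathrm{vec}(\boldsymbol\varepsilon)=O_p(\sqrt N)$; (c) $\operatorname{rank}(\boldsymbol{\mathcal A}_{(n)})=r_n$ wpa1; (d) for some $b>0$, wpa1, $\sum_{s=r_n+\widehat r_n+1}^{\min\{N_n,N_{-n}\}}\sigma_s^2\big(N^{-1/2}\sum_k\delta_k\boldsymbol X_{k,(n)}\big)>b$ for all $\delta\in\mathbb R^K$ with $\|\delta\|=1$, where $\sigma_s$ is the $s$-th largest singular value. **Moment and weak-dependence conditions** (bounds uniform over indices and sample sizes): (i) $\mathbb E\|X_{i_1\dots i_d}\|^4$ is bounded; (ii) for each $n$, $\mathbb E\|\varphi^{(n)}_{i_n}\|^4$ is bounded and $N_n^{-1}\sum_{i_n}\varphi^{(n)}_{i_n}\varphi^{(n)\prime}_{i_n}$ converges in probability to a nonrandom positive definite $r_n\times r_n$ matrix; (iii) $\mathbb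 E\varepsilon_{i_1\dots i_d}=0$ and $\mathbb E\varepsilon_{i_1\dots i_d}^8$ is bounded; (iv) $N^{-1}\sum_{i}\sum_{i'}|\mathbb E\,\varepsilon_{i}\varepsilon_{i'}|$ is bounded, where $i,i'$ run over all $d$-tuples of indices; (v) each $\varepsilon_{i}$ is independent of each $X_{i'}$ and of each $\varphi^{(n)}_{i_n'}$; (vi) for each $n$, with $\varepsilon_{it}$ the entries of $\boldsymbol\varepsilon_{(n)}$, $N_n^{-2}N_{-n}^{-1}\sum_{i,j,k,m}\sum_{t}|\mathrm{cov}(\varepsilon_{it}\varepsilon_{jt},\varepsilon_{kt}\varepsilon_{mt})|$ is bounded. **Estimator.** Separately for each $n$, let $\widehat\beta_{(n)}$ minimise over $\beta\in\mathbb R^K$ $$\min_{F\in\mathbb R^{N_n\times\widehat r_n},\ \Gamma\in\mathbb R^{N_{-n}\times\widehat r_n}}\Big\|\boldsymbol Y_{(n)}-\sum_k\boldsymbol X_{k,(n)}\beta_k-F\Gamma'\Big\|_F^2 ,$$ let $\widehat U_n$ be the first $\widehat r_n$ left singular vectors of a singular value decomposition of $\boldsymbol Y_{(n)}-\sum_k\boldsymbol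 X_{k,(n)}\widehat\beta_{(n),k}$ and $\widehat\Sigma_n$ the diagonal matrix of the corresponding singular values (it suffices that these relations hold wpa1). The proxies $\widehat\varphi^{(n)}_{i_n}$ are the rows of $N_{-n}^{-1/2}\,\widehat U_n\widehat\Sigma_n$. **Claim.** For every $n=1,\dots,d$ the proxies estimate the factors, up to rotation, at the rate $C_n^{-2}=1/\min\{N_n,\prod_{n'\ne n}N_{n'}\}$: there are random matrices $H_n\in\mathbb R^{r_n\times\widehat r_n}$ and $G_n\in\mathbb R^{\widehat r_n\times r_n}$ with $\|H_n\|_F=O_p(1)$, $\|G_n\|_F=O_p(1)$ and $H_nG_n=I_{r_n}$ wpa1, such that $$\frac1{N_n}\sum_{i_n=1}^{N_n}\big\|\widehat\varphi^{(n)}_{i_n}-H_n'\varphi^{(n)}_{i_n}\big\|^2=O_p(C_n^{-2}),\qquad \frac1{N_n}\sum_{i_n=1}^{N_n}\big\|G_n'\widehat\varphi^{(n)}_{i_n}-\varphi^{(n)}_{i_n}\big\|^2=O_p(C_n^{-2}).$$ If $\widehat r_n=r_n$, the same holds (with possibly different $H_n$, $G_n$) for the proxies normalised as the rows of $\sqrt{N_n}\,\widehat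 U_n$. -/

import Mathlib

open MeasureTheory ProbabilityTheory Filter Topology
open scoped ENNReal Matrix

namespace TensorPanel

noncomputable section

/-! ### Stochastic order along an array of probability spaces

`Ω m`, `P m` is the probability space of the `m`-th sample, and `l` is the filter along which the
sample sizes grow. Probabilities of arbitrary sets are outer probabilities. -/

/-- The event `E` holds with probability approaching one. -/
def Wpa1 {ι : Type*} (l : Filter ι) {Ω : ι → Type*} [∀ m, MeasurableSpace (Ω m)]
    (P : ∀ m, Measure (Ω m)) (E : ∀ m, Ω m → Prop) : Prop :=
  Tendsto (fun m => P m {ω | ¬ E m ω}) l (𝓝 0)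

/-- `Z = O_p(a)`. -/
def IsBigOp {ι : Type*} (l : Filter ι) {Ω : ι → Type*} [∀ m, MeasurableSpace (Ω m)]
    (P : ∀ m, Measure (Ω m)) (Z : ∀ m, Ω m → ℝ) (a : ι → ℝ) : Prop :=
  ∀ η : ℝ≥0∞, 0 < η → ∃ M : ℝ, ∀ᶠ m in l, P m {ω | M * a m < |Z m ω|} ≤ η

/-- `Z` converges in probability to the constant `c`. -/
def TendstoInProb {ι : Type*} (l : Filter ι) {Ω : ι → Type*} [∀ m, MeasurableSpace (Ω m)]
    (P : ∀ m, Measure (Ω m)) (Z : ∀ m, Ω m → ℝ) (c : ℝ) : Prop :=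
  ∀ η : ℝ, 0 < η → Wpa1 l P fun m ω => |Z m ω - c| < η

/-! ### Matrices -/

/-- Squared Frobenius norm. -/
def frobSq {α β : Type*} [Fintype α] [Fintype β] (A : Matrix α β ℝ) : ℝ :=
  ∑ i, ∑ j, A i j ^ 2

/-- Spectral norm: the operator norm between Euclidean spaces. -/
def specNorm {α β : Type*} [Fintype α] [Fintype β] [DecidableEq β] (A : Matrix α β ℝ) : ℝ :=
  ‖LinearMap.toContinuousLinearMap (Matrix.toEuclideanLin A)‖

/-- The singular values in decreasing order; the index starts at `0`. -/
def singVal {α β : Type*} [Fintype α] [Fintype β] [DecidableEq β] (A : Matrix α β ℝ) (s : ℕ) : ℝ :=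
  (Matrix.toEuclideanLin A).singularValues s

/-- `A = U diag(σ) Vᵀ` is a singular value decomposition with `p = min (#rows) (#columns)` terms:
orthonormal left and right singular vectors, and nonnegative decreasing singular values. -/
structure IsSVD {α β : Type*} [Fintype α] [Fintype β]
    (A : Matrix α β ℝ) {p : ℕ} (U : Matrix α (Fin p) ℝ) (σ : Fin p → ℝ) (V : Matrix β (Fin p) ℝ) :
    Prop where
  size : p = min (Fintype.card α) (Fintype.card β)
  left_orthonormal : Uᵀ * U = 1
  right_orthonormal : Vᵀ * V = 1
  nonneg : ∀ s, 0 ≤ σ s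
  antitone : Antitone σ
  eq : A = U * Matrix.diagonal σ * Vᵀ

/-- The columns of `U` are the first `k` left singular vectors, and `s` the first `k` singular
values, of some singular value decomposition of `A`. -/
def IsLeadingSVD {α β : Type*} [Fintype α] [Fintype β]
    (A : Matrix α β ℝ) {k : ℕ} (U : Matrix α (Fin k) ℝ) (s : Fin k → ℝ) : Prop :=
  ∃ (p : ℕ) (U' : Matrix α (Fin p) ℝ) (σ : Fin p → ℝ) (V : Matrix β (Fin p) ℝ) (hk : k ≤ p),
    IsSVD A U' σ V ∧ (∀ i j, U i j = U' i (Fin.castLE hk j)) ∧ ∀ j, s j = σ (Fin.castLE hk j)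

/-! ### Tensors and the model -/

/-- Real tensors of size `N 0 × ⋯ × N (d - 1)`. -/
abbrev Tensor {d : ℕ} (N : Fin d → ℕ) : Type := (∀ k : Fin d, Fin (N k)) → ℝ

/-- The joint index over all dimensions but `n`. -/
abbrev CoIndex {d : ℕ} (N : Fin d → ℕ) (n : Fin d) : Type := ∀ k : {k : Fin d // k ≠ n}, Fin (N k)

/-- `∏_n N_n`. -/
def total {d : ℕ} (N : Fin d → ℕ) : ℝ := ∏ k, (N k : ℝ)

/-- `∏_{n' ≠ n} N_{n'}`. -/
def coSize {d : ℕ} (N : Fin d → ℕ) (n : Fin d) : ℝ := ∏ k ∈ Finset.univ.erase n, (N k : ℝ)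

/-- The flattening of a tensor in dimension `n`: dimension `n` indexes the rows, and all the other
dimensions jointly index the columns. -/
def flatten {d : ℕ} {N : Fin d → ℕ} (n : Fin d) (T : Tensor N) :
    Matrix (Fin (N n)) (CoIndex N n) ℝ :=
  fun i j => T ((Equiv.piSplitAt n fun k => Fin (N k)).symm (i, j))

/-- The interactive effect `∑_ℓ φ_ℓ^{(1)} ∘ ⋯ ∘ φ_ℓ^{(d)}`; `φ_ℓ^{(n)}` is column `ℓ` of `Φ n`. -/
def interactive {d L : ℕ} {N : Fin d → ℕ} (Φ : ∀ n, Matrix (Fin (N n)) (Fin L) ℝ) : Tensor N :=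
  fun i => ∑ ℓ, ∏ n, Φ n (i n) ℓ

/-- The tensor `∑_k b_k X_k`. -/
def lin {d K : ℕ} {N : Fin d → ℕ} (X : Fin K → Tensor N) (b : Fin K → ℝ) : Tensor N :=
  fun i => ∑ k, X k i * b k

/-- The outcome `Y = ∑_k X_k β_k + 𝒜 + ε`. -/
def outcome {d K L : ℕ} {N : Fin d → ℕ} (X : Fin K → Tensor N) (β : Fin K → ℝ)
    (Φ : ∀ n, Matrix (Fin (N n)) (Fin L) ℝ) (ε : Tensor N) : Tensor N :=
  fun i => lin X β i + interactive Φ i + ε i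

/-! ### The estimator -/

/-- The residual `Y - ∑_k b_k X_k`, flattened in dimension `n`. -/
def residual {d K : ℕ} {N : Fin d → ℕ} (n : Fin d) (Y : Tensor N) (X : Fin K → Tensor N)
    (b : Fin K → ℝ) : Matrix (Fin (N n)) (CoIndex N n) ℝ :=
  flatten n fun i => Y i - lin X b i

/-- The least squares objective with `k` factors, minimised over factors and loadings. -/
def profileObjective {d K : ℕ} {N : Fin d → ℕ} (n : Fin d) (k : ℕ) (Y : Tensor N)
    (X : Fin K → Tensor N) (b : Fin K → ℝ) : ℝ :=
  ⨅ p : Matrix (Fin (N n)) (Fin k) ℝ × Matrix (CoIndex N n) (Fin k) ℝ,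
    frobSq (residual n Y X b - p.1 * p.2ᵀ)

/-- `b` is the interactive-effects least squares slope estimate, and `U`, `s` are the leading `k`
left singular vectors and singular values of the residual at `b`. -/
structure IsLSEstimate {d K : ℕ} {N : Fin d → ℕ} (n : Fin d) (k : ℕ) (Y : Tensor N)
    (X : Fin K → Tensor N) (b : Fin K → ℝ) (U : Matrix (Fin (N n)) (Fin k) ℝ) (s : Fin k → ℝ) :
    Prop where
  slope : ∀ b' : Fin K → ℝ, profileObjective n k Y X b ≤ profileObjective n k Y X b'
  leading : IsLeadingSVD (residual n Y X b) U s

/-- Factor proxies: the leading columns of `U Σ`, divided by `(∏_{n' ≠ n} N_{n'})^{1/2}`. -/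
def scoreProxy {d k : ℕ} {N : Fin d → ℕ} (n : Fin d) (U : Matrix (Fin (N n)) (Fin k) ℝ)
    (s : Fin k → ℝ) : Matrix (Fin (N n)) (Fin k) ℝ :=
  (Real.sqrt (coSize N n))⁻¹ • (U * Matrix.diagonal s)

/-- Factor proxies under the normalisation `F'F / N_n = I`: the leading columns of `√N_n U`. -/
def unitProxy {d k : ℕ} {N : Fin d → ℕ} (n : Fin d) (U : Matrix (Fin (N n)) (Fin k) ℝ) :
    Matrix (Fin (N n)) (Fin k) ℝ :=
  Real.sqrt (N n) • U

/-! ### Assumptions -/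

/-- Conditions for the slope estimates from each of the flattenings: bounded norms, weak
exogeneity, low multilinear rank, and non-singularity after projecting out factors. The interactive
effect is `interactive (Φ m ω)`. -/
structure FlatteningConditions {ι : Type*} (l : Filter ι) {Ω : ι → Type*}
    [∀ m, MeasurableSpace (Ω m)] (P : ∀ m, Measure (Ω m)) {d K L : ℕ} (N : ι → Fin d → ℕ)
    (r rhat : Fin d → ℕ) (Φ : ∀ m, Ω m → ∀ n, Matrix (Fin (N m n)) (Fin L) ℝ)
    (X : ∀ m, Ω m → Fin K → Tensor (N m)) (ε : ∀ m, Ω m → Tensor (N m)) : Prop where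
  norm_X : ∀ k, IsBigOp l P (fun m ω => Real.sqrt (∑ i, X m ω k i ^ 2))
    fun m => Real.sqrt (total (N m))
  norm_ε : ∀ n, IsBigOp l P (fun m ω => specNorm (flatten n (ε m ω)))
    fun m => max (Real.sqrt (N m n)) (Real.sqrt (coSize (N m) n))
  exog : ∀ k, IsBigOp l P (fun m ω => ∑ i, X m ω k i * ε m ω i)
    fun m => Real.sqrt (total (N m))
  rank_eq : ∀ n, Wpa1 l P fun m ω => (flatten n (interactive (Φ m ω))).rank = r n
  nonsing : ∀ n, ∃ b : ℝ, 0 < b ∧ Wpa1 l P fun m ω =>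
    ∀ δ : Fin K → ℝ, ∑ k, δ k ^ 2 = 1 →
      b < ∑ s ∈ Finset.Ico (r n + rhat n) (min (N m n) (Fintype.card (CoIndex (N m) n))),
        singVal ((Real.sqrt (total (N m)))⁻¹ • flatten n (lin (X m ω) δ)) s ^ 2

/-- Moment and weak-dependence conditions on the regressors, the factors (row `i` of `φ m ω n` is
the factor `φ_i^{(n)}`, a vector with `r n` entries) and the errors. -/
structure MomentConditions {ι : Type*} (l : Filter ι) {Ω : ι → Type*}
    [∀ m, MeasurableSpace (Ω m)] (P : ∀ m, Measure (Ω m)) {d K : ℕ} (N : ι → Fin d → ℕ)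
    (r : Fin d → ℕ) (φ : ∀ m, Ω m → ∀ n, Matrix (Fin (N m n)) (Fin (r n)) ℝ)
    (X : ∀ m, Ω m → Fin K → Tensor (N m)) (ε : ∀ m, Ω m → Tensor (N m)) : Prop where
  meas_X : ∀ m k i, Measurable fun ω => X m ω k i
  meas_φ : ∀ m n i q, Measurable fun ω => φ m ω n i q
  meas_ε : ∀ m i, Measurable fun ω => ε m ω i
  moment_X : ∃ M : ℝ, ∀ m i,
    MemLp (fun ω => WithLp.toLp 2 fun k => X m ω k i) 4 (P m) ∧
      ∫ ω, ‖WithLp.toLp 2 fun k => X m ω k i‖ ^ 4 ∂(P m) ≤ M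
  moment_φ : ∀ n, ∃ M : ℝ, ∀ m i,
    MemLp (fun ω => WithLp.toLp 2 (φ m ω n i)) 4 (P m) ∧
      ∫ ω, ‖WithLp.toLp 2 (φ m ω n i)‖ ^ 4 ∂(P m) ≤ M
  gram_φ : ∀ n, ∃ S : Matrix (Fin (r n)) (Fin (r n)) ℝ, S.PosDef ∧
    ∀ a b, TendstoInProb l P (fun m ω => (N m n : ℝ)⁻¹ * ((φ m ω n)ᵀ * φ m ω n) a b) (S a b)
  mean_ε : ∀ m i, ∫ ω, ε m ω i ∂(P m) = 0
  moment_ε : ∃ M : ℝ, ∀ m i, MemLp (fun ω => ε m ω i) 8 (P m) ∧ ∫ ω, ε m ω i ^ 8 ∂(P m) ≤ M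
  weak_dep : ∃ M : ℝ, ∀ m,
    (total (N m))⁻¹ * ∑ i, ∑ j, |∫ ω, ε m ω i * ε m ω j ∂(P m)| ≤ M
  indep_X : ∀ m i j, IndepFun (fun ω => ε m ω i) (fun ω k => X m ω k j) (P m)
  indep_φ : ∀ m i n j, IndepFun (fun ω => ε m ω i) (fun ω => φ m ω n j) (P m)
  weak_dep_sq : ∀ n, ∃ M : ℝ, ∀ m,
    ((N m n : ℝ) ^ 2)⁻¹ * (coSize (N m) n)⁻¹ *
      ∑ i, ∑ j, ∑ i', ∑ j', ∑ t,
        |covariance (fun ω => flatten n (ε m ω) i t * flatten n (ε m ω) j t)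
          (fun ω => flatten n (ε m ω) i' t * flatten n (ε m ω) j' t) (P m)| ≤ M

/-! ### The conclusion -/

/-- The rows of `F` estimate the rows of `φ` at mean squared error `O_p(a)` up to rotation: there
are rotations `H`, bounded in probability and with (wpa1) a right inverse `G` that is bounded in
probability, such that `N⁻¹ ∑_i ‖F_i - H'φ_i‖² = O_p(a)` and `N⁻¹ ∑_i ‖G'F_i - φ_i‖² = O_p(a)`. -/
def ProxyRate {ι : Type*} (l : Filter ι) {Ω : ι → Type*} [∀ m, MeasurableSpace (Ω m)]
    (P : ∀ m, Measure (Ω m)) {n : ι → ℕ} {r k : ℕ}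
    (F : ∀ m, Ω m → Matrix (Fin (n m)) (Fin k) ℝ)
    (φ : ∀ m, Ω m → Matrix (Fin (n m)) (Fin r) ℝ) (a : ι → ℝ) : Prop :=
  ∃ (H : ∀ m, Ω m → Matrix (Fin r) (Fin k) ℝ) (G : ∀ m, Ω m → Matrix (Fin k) (Fin r) ℝ),
    IsBigOp l P (fun m ω => frobSq (H m ω)) (fun _ => 1) ∧
    IsBigOp l P (fun m ω => frobSq (G m ω)) (fun _ => 1) ∧
    Wpa1 l P (fun m ω => H m ω * G m ω = 1) ∧
    IsBigOp l P (fun m ω => (n m : ℝ)⁻¹ * frobSq (F m ω - φ m ω * H m ω)) a ∧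
    IsBigOp l P (fun m ω => (n m : ℝ)⁻¹ * frobSq (F m ω * G m ω - φ m ω)) a

end

end TensorPanel

namespace TensorPanel

/-! ### Frobenius and operator bounds -/

section Frob

variable {α β γ : Type*} [Fintype α] [Fintype β] [Fintype γ]

theorem frobSq_nonneg (A : Matrix α β ℝ) : 0 ≤ frobSq A :=
  Finset.sum_nonneg fun _ _ => Finset.sum_nonneg fun _ _ => sq_nonneg _

theorem frobSq_transpose (A : Matrix α β ℝ) : frobSq Aᵀ = frobSq A := by
  unfold frobSq
  rw [Finset.sum_comm]
  rfl

theorem frobSq_smul (c : ℝ) (A : Matrix α β ℝ) : frobSq (c • A) = c ^ 2 * frobSq A := by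
  simp [frobSq, mul_pow, Finset.mul_sum]

theorem frobSq_neg (A : Matrix α β ℝ) : frobSq (-A) = frobSq A := by
  simp [frobSq]

theorem frobSq_add_le (A B : Matrix α β ℝ) : frobSq (A + B) ≤ 2 * frobSq A + 2 * frobSq B := by
  simp only [frobSq, Finset.mul_sum, ← Finset.sum_add_distrib]
  refine Finset.sum_le_sum fun i _ => Finset.sum_le_sum fun j _ => ?_
  rw [Matrix.add_apply]
  nlinarith [sq_nonneg (A i j - B i j)]

theorem frobSq_mul_le (A : Matrix α β ℝ) (B : Matrix β γ ℝ) :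
    frobSq (A * B) ≤ frobSq A * frobSq B := by
  have h : frobSq A * frobSq B = ∑ i, ∑ j, (∑ k, A i k ^ 2) * ∑ k, B k j ^ 2 := by
    rw [← frobSq_transpose B, frobSq, frobSq, Finset.sum_mul_sum]
    rfl
  rw [h]
  exact Finset.sum_le_sum fun i _ => Finset.sum_le_sum fun j _ =>
    Finset.sum_mul_sq_le_sq_mul_sq _ _ _

theorem frobSq_eq_trace (A : Matrix α β ℝ) : frobSq A = (Aᵀ * A).trace := by
  rw [← frobSq_transpose]
  simp [frobSq, Matrix.trace, Matrix.mul_apply, sq]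

theorem frobSq_eq_trace' (A : Matrix α β ℝ) : frobSq A = (A * Aᵀ).trace := by
  simp [frobSq, Matrix.trace, Matrix.mul_apply, sq]

theorem frobSq_of_orthonormal [DecidableEq β] {V : Matrix α β ℝ} (h : Vᵀ * V = 1) :
    frobSq V = Fintype.card β := by
  rw [frobSq_eq_trace, h, Matrix.trace_one]

theorem frobSq_eq_sum_col (A : Matrix α β ℝ) : frobSq A = ∑ j, A.col j ⬝ᵥ A.col j := by
  rw [← frobSq_transpose]
  simp [frobSq, dotProduct, sq]

theorem frobSq_one [DecidableEq α] : frobSq (1 : Matrix α α ℝ) = Fintype.card α :=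
  frobSq_of_orthonormal (by simp)

/-- The squared operator norm of `A` is at most `c`. -/
def OpBound (A : Matrix α β ℝ) (c : ℝ) : Prop :=
  ∀ x : β → ℝ, A *ᵥ x ⬝ᵥ A *ᵥ x ≤ c * (x ⬝ᵥ x)

theorem dotProduct_self_nonneg' (x : α → ℝ) : 0 ≤ x ⬝ᵥ x :=
  Finset.sum_nonneg fun _ _ => mul_self_nonneg _

theorem OpBound.frobSq_mul_le {A : Matrix α β ℝ} {c : ℝ} (h : OpBound A c) (B : Matrix β γ ℝ) :
    frobSq (A * B) ≤ c * frobSq B := by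
  rw [frobSq_eq_sum_col, frobSq_eq_sum_col, Finset.mul_sum]
  exact Finset.sum_le_sum fun j _ => h (B.col j)

theorem OpBound.mono {A : Matrix α β ℝ} {c c' : ℝ} (h : OpBound A c) (hc : c ≤ c') :
    OpBound A c' :=
  fun x => (h x).trans (mul_le_mul_of_nonneg_right hc (dotProduct_self_nonneg' x))

theorem OpBound.sub {A B : Matrix α β ℝ} {c c' : ℝ} (h : OpBound A c) (h' : OpBound B c') :
    OpBound (A - B) (2 * c + 2 * c') := by
  intro x
  have key : (A - B) *ᵥ x ⬝ᵥ (A - B) *ᵥ x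
      ≤ 2 * (A *ᵥ x ⬝ᵥ A *ᵥ x) + 2 * (B *ᵥ x ⬝ᵥ B *ᵥ x) := by
    rw [Matrix.sub_mulVec]
    simp only [dotProduct, Finset.mul_sum, ← Finset.sum_add_distrib]
    refine Finset.sum_le_sum fun i _ => ?_
    rw [Pi.sub_apply]
    nlinarith [sq_nonneg ((A *ᵥ x) i + (B *ᵥ x) i)]
  linarith [h x, h' x]

theorem opBound_frobSq (A : Matrix α β ℝ) : OpBound A (frobSq A) := by
  intro x
  simp only [frobSq, Finset.sum_mul, dotProduct, Matrix.mulVec]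
  refine Finset.sum_le_sum fun i _ => ?_
  have := Finset.sum_mul_sq_le_sq_mul_sq Finset.univ (A i) x
  simpa [sq, Finset.sum_mul] using this

theorem opBound_specNorm [DecidableEq β] (A : Matrix α β ℝ) : OpBound A (specNorm A ^ 2) := by
  intro x
  have h := (LinearMap.toContinuousLinearMap (Matrix.toEuclideanLin A)).le_opNorm (WithLp.toLp 2 x)
  have h2 := pow_le_pow_left₀ (norm_nonneg _) h 2
  rw [mul_pow, EuclideanSpace.real_norm_sq_eq, EuclideanSpace.real_norm_sq_eq] at h2
  simpa [dotProduct, sq, specNorm] using h2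

/-- A small perturbation of the identity has a bounded inverse. -/
theorem exists_inv_one_sub {r : ℕ} (D : Matrix (Fin r) (Fin r) ℝ) (hD : frobSq D ≤ 1 / 4) :
    ∃ J : Matrix (Fin r) (Fin r) ℝ, (1 - D) * J = 1 ∧ frobSq J ≤ 4 * r := by
  have hinj : Function.Injective (1 - D).mulVec := by
    refine (injective_iff_map_eq_zero (1 - D).mulVecLin).2 fun x hx => ?_
    have hx' : D *ᵥ x = x := by
      rw [Matrix.mulVecLin_apply, Matrix.sub_mulVec, Matrix.one_mulVec, sub_eq_zero] at hx
      exact hx.symm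
    have := opBound_frobSq D x
    rw [hx'] at this
    have h0 : x ⬝ᵥ x = 0 := by nlinarith [dotProduct_self_nonneg' x]
    exact dotProduct_self_eq_zero.1 h0
  obtain ⟨J, hJ⟩ := (Matrix.mulVec_injective_iff_isUnit.1 hinj).exists_right_inv
  refine ⟨J, hJ, ?_⟩
  have hJ' : J = 1 + D * J := by
    rw [Matrix.sub_mul, Matrix.one_mul] at hJ
    rw [← hJ]
    abel
  have h1 := frobSq_add_le 1 (D * J)
  rw [← hJ', frobSq_one, Fintype.card_fin] at h1
  have h2 := frobSq_mul_le D J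
  nlinarith [frobSq_nonneg J]

end Frob

/-! ### Singular values and singular vectors -/

section Singular

theorem sum_Ico_le_sum_weighted {f u : ℕ → ℝ} {n k : ℕ} (hf : Antitone f) (hf0 : ∀ s, 0 ≤ f s)
    (hu0 : ∀ s, 0 ≤ u s) (hu1 : ∀ s, u s ≤ 1) (hu : (n : ℝ) - k ≤ ∑ s ∈ Finset.range n, u s) :
    ∑ s ∈ Finset.Ico k n, f s ≤ ∑ s ∈ Finset.range n, f s * u s := by
  rcases le_total n k with h | h
  · rw [Finset.Ico_eq_empty_of_le h, Finset.sum_empty]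
    exact Finset.sum_nonneg fun s _ => mul_nonneg (hf0 s) (hu0 s)
  · have h1 : ∑ s ∈ Finset.range n, (f k * u s + if k ≤ s then f s - f k else 0)
        ≤ ∑ s ∈ Finset.range n, f s * u s := by
      refine Finset.sum_le_sum fun s _ => ?_
      split_ifs with hs
      · nlinarith [mul_nonneg (sub_nonneg.2 (hf hs)) (sub_nonneg.2 (hu1 s))]
      · nlinarith [mul_nonneg (sub_nonneg.2 (hf (not_le.1 hs).le)) (hu0 s)]
    have h2 : ∑ s ∈ Finset.range n, (if k ≤ s then f s - f k else 0)
        = ∑ s ∈ Finset.Ico k n, (f s - f k) := by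
      rw [← Finset.sum_filter]
      congr 1
      ext s
      simp [and_comm]
    rw [Finset.sum_add_distrib, h2, ← Finset.mul_sum, Finset.sum_sub_distrib, Finset.sum_const,
      Nat.card_Ico, nsmul_eq_mul, Nat.cast_sub h] at h1
    nlinarith [mul_le_mul_of_nonneg_left hu (hf0 k)]

variable {α β γ : Type*} [Fintype α] [Fintype β] [Fintype γ]

theorem transpose_mul_self_of_orthonormal {k : ℕ} {v : Fin k → EuclideanSpace ℝ β}
    (hv : Orthonormal ℝ v) :
    (Matrix.of fun i s => v s i : Matrix β (Fin k) ℝ)ᵀ * (Matrix.of fun i s => v s i) = 1 := by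
  ext s t
  have := orthonormal_iff_ite.1 hv s t
  rw [PiLp.inner_apply] at this
  simp only [Matrix.mul_apply, Matrix.transpose_apply, Matrix.one_apply]
  rw [← this]
  refine Finset.sum_congr rfl fun i _ => ?_
  simp [mul_comm]

/-- An orthonormal basis of the column space. -/
theorem exists_orthonormal_columns (C : Matrix β γ ℝ) :
    ∃ k ≤ Fintype.card γ, ∃ Q : Matrix β (Fin k) ℝ, Qᵀ * Q = 1 ∧ Q * Qᵀ * C = C := by
  let c : γ → EuclideanSpace ℝ β := fun j => WithLp.toLp 2 (C.col j)
  let W := Submodule.span ℝ (Set.range c)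
  let b := stdOrthonormalBasis ℝ W
  refine ⟨_, finrank_range_le_card (R := ℝ) c, Matrix.of fun i s => (b s : EuclideanSpace ℝ β) i,
    ?_, ?_⟩
  · exact transpose_mul_self_of_orthonormal (b.orthonormal.comp_linearIsometry W.subtypeₗᵢ)
  · ext i j
    have hj : c j ∈ W := Submodule.subset_span ⟨j, rfl⟩
    have h := congrArg (fun w : W => (w : EuclideanSpace ℝ β) i) (b.sum_repr' ⟨c j, hj⟩)
    simp only [Submodule.coe_sum, Submodule.coe_smul, Submodule.coe_inner, WithLp.ofLp_sum,
      Finset.sum_apply, WithLp.ofLp_smul, Pi.smul_apply, smul_eq_mul, PiLp.inner_apply] at h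
    rw [Matrix.mul_assoc, Matrix.mul_apply]
    refine Eq.trans (Finset.sum_congr rfl fun s _ => ?_) h
    rw [mul_comm, Matrix.mul_apply]
    congr 1
    refine Finset.sum_congr rfl fun t _ => ?_
    simp [c, mul_comm]

theorem dotProduct_mulVec_self_of_orthonormal {k : ℕ} {V : Matrix β (Fin k) ℝ} (hV : Vᵀ * V = 1)
    (x : Fin k → ℝ) : V *ᵥ x ⬝ᵥ V *ᵥ x = x ⬝ᵥ x := by
  rw [Matrix.dotProduct_mulVec, Matrix.vecMul_mulVec, hV, Matrix.vecMul_one]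

theorem transpose_submatrix_mul_self {p q : ℕ} {W : Matrix β (Fin p) ℝ} (hW : Wᵀ * W = 1)
    {f : Fin q → Fin p} (hf : Function.Injective f) :
    (W.submatrix id f)ᵀ * W.submatrix id f = 1 := by
  have e : (W.submatrix id f)ᵀ * W.submatrix id f = (Wᵀ * W).submatrix f f := by
    ext i j
    simp [Matrix.mul_apply]
  rw [e, hW, Matrix.submatrix_one _ hf]

theorem dotProduct_transpose_mulVec_le {k : ℕ} {V : Matrix β (Fin k) ℝ} (hV : Vᵀ * V = 1)
    (x : β → ℝ) : Vᵀ *ᵥ x ⬝ᵥ Vᵀ *ᵥ x ≤ x ⬝ᵥ x := by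
  have h := dotProduct_self_nonneg' (x - V *ᵥ (Vᵀ *ᵥ x))
  have h1 : x ⬝ᵥ V *ᵥ (Vᵀ *ᵥ x) = Vᵀ *ᵥ x ⬝ᵥ Vᵀ *ᵥ x := by
    rw [Matrix.dotProduct_mulVec, ← Matrix.mulVec_transpose]
  rw [sub_dotProduct, dotProduct_sub, dotProduct_sub, dotProduct_mulVec_self_of_orthonormal hV,
    dotProduct_comm (V *ᵥ _) x, h1] at h
  linarith

theorem IsSVD.mul_submatrix {A : Matrix α β ℝ} {p q : ℕ} {U : Matrix α (Fin p) ℝ} {σ : Fin p → ℝ}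
    {V : Matrix β (Fin p) ℝ} (h : IsSVD A U σ V) (f : Fin q → Fin p) :
    A * V.submatrix id f = U.submatrix id f * Matrix.diagonal (σ ∘ f) := by
  have e : A * V.submatrix id f = (A * V).submatrix id f := by
    ext i j
    simp [Matrix.mul_apply]
  rw [e, h.eq, Matrix.mul_assoc, h.right_orthonormal, Matrix.mul_one]
  ext i j
  simp [Matrix.mul_diagonal]

/-- A matrix of rank `r ≤ k` approximates `A` no better than the `k`-th singular value. -/
theorem IsSVD.sq_le_of_opBound {A : Matrix α β ℝ} {p r k : ℕ} {U : Matrix α (Fin p) ℝ}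
    {σ : Fin p → ℝ} {V : Matrix β (Fin p) ℝ} (h : IsSVD A U σ V) (hrk : r ≤ k)
    {φ : Matrix α (Fin r) ℝ} {Γ : Matrix β (Fin r) ℝ} {c : ℝ} (hE : OpBound (A - φ * Γᵀ) c)
    (i : Fin p) (hi : k ≤ i) : σ i ^ 2 ≤ c := by
  have hp : k + 1 ≤ p := by omega
  set f : Fin (k + 1) → Fin p := Fin.castLE hp
  have hf : Function.Injective f := Fin.castLE_injective hp
  set W := V.submatrix id f with hW
  have hWW : Wᵀ * W = 1 := transpose_submatrix_mul_self h.right_orthonormal hf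
  obtain ⟨y, hy, hy0⟩ := Submodule.exists_mem_ne_zero_of_ne_bot
    (LinearMap.ker_ne_bot_of_finrank_lt (f := (Γᵀ * W).mulVecLin) (by simp; omega))
  have hy' : (Γᵀ * W) *ᵥ y = 0 := hy
  have h1 := hE (W *ᵥ y)
  rw [dotProduct_mulVec_self_of_orthonormal hWW, Matrix.sub_mulVec, Matrix.mulVec_mulVec,
    Matrix.mulVec_mulVec, Matrix.mul_assoc, ← Matrix.mulVec_mulVec _ φ, hy', Matrix.mulVec_zero,
    sub_zero, h.mul_submatrix, ← Matrix.mulVec_mulVec, dotProduct_mulVec_self_of_orthonormal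
      (transpose_submatrix_mul_self h.left_orthonormal hf)] at h1
  have h2 : σ i ^ 2 * (y ⬝ᵥ y)
      ≤ Matrix.diagonal (σ ∘ f) *ᵥ y ⬝ᵥ Matrix.diagonal (σ ∘ f) *ᵥ y := by
    simp only [dotProduct, Finset.mul_sum, Matrix.mulVec_diagonal, Function.comp_apply]
    refine Finset.sum_le_sum fun j _ => ?_
    have hj : σ i ^ 2 ≤ σ (f j) ^ 2 := by
      refine pow_le_pow_left₀ (h.nonneg i) (h.antitone ?_) 2
      rw [Fin.le_def]
      simp only [f, Fin.val_castLE]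
      omega
    nlinarith [mul_le_mul_of_nonneg_right hj (mul_self_nonneg (y j))]
  have h3 : 0 < y ⬝ᵥ y := lt_of_le_of_ne (dotProduct_self_nonneg' y)
    fun h0 => hy0 (dotProduct_self_eq_zero.1 h0.symm)
  exact le_of_mul_le_mul_right (h2.trans h1) h3

variable [DecidableEq β]

theorem exists_eigenbasis_singVal [DecidableEq α] (A : Matrix α β ℝ) :
    ∃ O : Matrix β (Fin (Fintype.card β)) ℝ, Oᵀ * O = 1 ∧ O * Oᵀ = 1 ∧
      Aᵀ * A = O * Matrix.diagonal (fun s : Fin (Fintype.card β) => singVal A s ^ 2) * Oᵀ := by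
  have hn : Module.finrank ℝ (EuclideanSpace ℝ β) = Fintype.card β := finrank_euclideanSpace
  set T := Matrix.toEuclideanLin A with hT
  set v := T.isSymmetric_adjoint_comp_self.eigenvectorBasis hn with hv
  let O : Matrix β (Fin (Fintype.card β)) ℝ := Matrix.of fun i s => v s i
  have h1 : Oᵀ * O = 1 := transpose_mul_self_of_orthonormal v.orthonormal
  have h2 : O * Oᵀ = 1 := 
    (Matrix.mul_eq_one_comm_of_card_eq _ _ _ (Fintype.card_fin _)).1 h1
  refine ⟨O, h1, h2, ?_⟩
  have h3 : Aᵀ * A * O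
      = O * Matrix.diagonal (fun s : Fin (Fintype.card β) => singVal A s ^ 2) := by
    ext i s
    have h4 : (LinearMap.adjoint T ∘ₗ T) (v s) = (T.singularValues s ^ 2 : ℝ) • v s := by
      rw [T.sq_singularValues_fin hn s]
      exact T.isSymmetric_adjoint_comp_self.apply_eigenvectorBasis hn s
    have hadj : LinearMap.adjoint T = Matrix.toEuclideanLin Aᴴ :=
      (Matrix.toEuclideanLin_conjTranspose_eq_adjoint A).symm
    rw [hadj] at h4
    have h5 := congrArg (fun w : EuclideanSpace ℝ β => w i) h4
    simp only [hT, LinearMap.comp_apply, Matrix.toLpLin_apply, Matrix.mulVec_mulVec,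
      Matrix.conjTranspose_eq_transpose_of_trivial, PiLp.smul_apply, smul_eq_mul] at h5
    rw [Matrix.mul_diagonal, mul_comm]
    exact h5
  rw [← h3, Matrix.mul_assoc, h2, Matrix.mul_one]

/-- Projecting the rows off `k` orthonormal vectors leaves at least the squared singular values
from the `k`-th on. -/
theorem sum_sq_singVal_le [DecidableEq α] (A : Matrix α β ℝ) {k k₀ m : ℕ} (hk : k ≤ k₀)
    (hm : m ≤ Fintype.card β) (Q : Matrix β (Fin k) ℝ) (hQ : Qᵀ * Q = 1) :
    ∑ s ∈ Finset.Ico k₀ m, singVal A s ^ 2 ≤ frobSq (A * (1 - Q * Qᵀ)) := by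
  obtain ⟨O, h1, h2, h3⟩ := exists_eigenbasis_singVal A
  set p : Matrix β β ℝ := 1 - Q * Qᵀ with hp
  have hpt : pᵀ = p := by simp [hp, Matrix.transpose_mul]
  have hQQ : Q * Qᵀ * (Q * Qᵀ) = Q * Qᵀ := by
    rw [Matrix.mul_assoc, ← Matrix.mul_assoc Qᵀ, hQ, Matrix.one_mul]
  have hpp : p * p = p := by
    rw [hp, Matrix.sub_mul, Matrix.mul_sub, Matrix.mul_sub, hQQ]
    simp
  set D := Oᵀ * p with hD
  let w : Fin (Fintype.card β) → ℝ := fun s => ∑ j, D s j ^ 2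
  have hw : ∀ s, w s = 1 - ∑ j, (Oᵀ * Q) s j ^ 2 := by
    intro s
    have e : D * Dᵀ = 1 - (Oᵀ * Q) * (Oᵀ * Q)ᵀ := by
      rw [hD, Matrix.transpose_mul, hpt, Matrix.mul_assoc, ← Matrix.mul_assoc p, hpp, hp,
        Matrix.transpose_mul, Matrix.transpose_transpose, Matrix.sub_mul, Matrix.mul_sub,
        Matrix.one_mul, h1]
      simp only [Matrix.mul_assoc]
    have := congrFun (congrFun e s) s
    simpa [Matrix.mul_apply, w, sq, mul_comm] using this
  have hf : frobSq (A * p) = ∑ s : Fin (Fintype.card β), singVal A s ^ 2 * w s := by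
    rw [frobSq_eq_trace, Matrix.transpose_mul, Matrix.mul_assoc, ← Matrix.mul_assoc Aᵀ, h3]
    have : pᵀ * (O * Matrix.diagonal (fun s : Fin (Fintype.card β) => singVal A s ^ 2) * Oᵀ * p)
        = Dᵀ * (Matrix.diagonal (fun s : Fin (Fintype.card β) => singVal A s ^ 2) * D) := by
      rw [hD, Matrix.transpose_mul, Matrix.transpose_transpose]
      simp only [Matrix.mul_assoc]
    rw [this, Matrix.trace_mul_comm, Matrix.trace]
    refine Finset.sum_congr rfl fun s _ => ?_
    simp only [Matrix.diag_apply, Matrix.mul_assoc, Matrix.diagonal_mul]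
    simp [Matrix.mul_apply, w, sq]
  have hwsum : ∑ s, w s = Fintype.card β - k := by
    have e : ∑ s, ∑ j, (Oᵀ * Q) s j ^ 2 = k := by
      have := frobSq_of_orthonormal (V := Oᵀ * Q) (by
        rw [Matrix.transpose_mul, Matrix.transpose_transpose, Matrix.mul_assoc,
          ← Matrix.mul_assoc O, h2, Matrix.one_mul, hQ])
      simpa [frobSq] using this
    simp only [hw, Finset.sum_sub_distrib, e]
    simp
  let u : ℕ → ℝ := fun s => if h : s < Fintype.card β then w ⟨s, h⟩ else 0
  have hu : ∀ s : Fin (Fintype.card β), u s = w s := fun s => by simp [u]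
  have hanti : Antitone fun s => singVal A s ^ 2 := fun a b hab =>
    pow_le_pow_left₀ (LinearMap.singularValues_nonneg _ _) (LinearMap.singularValues_antitone _ hab) 2
  calc ∑ s ∈ Finset.Ico k₀ m, singVal A s ^ 2
      ≤ ∑ s ∈ Finset.Ico k (Fintype.card β), singVal A s ^ 2 :=
        Finset.sum_le_sum_of_subset_of_nonneg (Finset.Ico_subset_Ico hk hm)
          fun _ _ _ => sq_nonneg _
    _ ≤ ∑ s ∈ Finset.range (Fintype.card β), singVal A s ^ 2 * u s := by
        refine sum_Ico_le_sum_weighted hanti (fun _ => sq_nonneg _) (fun s => ?_) (fun s => ?_) ?_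
        · by_cases h : s < Fintype.card β
          · simp only [u, h, dif_pos]
            exact Finset.sum_nonneg fun _ _ => sq_nonneg _
          · simp [u, h]
        · by_cases h : s < Fintype.card β
          · simp only [u, h, dif_pos, hw]
            exact sub_le_self _ (Finset.sum_nonneg fun _ _ => sq_nonneg _)
          · simp [u, h]
        · rw [← Fin.sum_univ_eq_sum_range, Finset.sum_congr rfl fun s _ => hu s, hwsum]
    _ = frobSq (A * p) := by
        rw [← Fin.sum_univ_eq_sum_range (fun s => singVal A s ^ 2 * u s), hf]
        exact Finset.sum_congr rfl fun s _ => by rw [hu s]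

/-- The content of a leading singular value decomposition: the leading right singular vectors, and
the operator norm of the remainder, which is no larger than the approximation error of any matrix
of rank at most `k`. -/
theorem IsLeadingSVD.exists_right {R : Matrix α β ℝ} {r k : ℕ} {U : Matrix α (Fin k) ℝ}
    {s : Fin k → ℝ} (h : IsLeadingSVD R U s) (hrk : r ≤ k) {φ : Matrix α (Fin r) ℝ}
    {Γ : Matrix β (Fin r) ℝ} {c : ℝ} (hc : 0 ≤ c) (hE : OpBound (R - φ * Γᵀ) c) :
    Uᵀ * U = 1 ∧ ∃ V : Matrix β (Fin k) ℝ, Vᵀ * V = 1 ∧ R * V = U * Matrix.diagonal s ∧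
      OpBound (R * (1 - V * Vᵀ)) c := by
  obtain ⟨p, U', σ, V', hk, hsvd, hU, hs⟩ := h
  obtain ⟨q, rfl⟩ := Nat.exists_eq_add_of_le hk
  have hUJ : U = U'.submatrix id (Fin.castAdd q) := by
    ext i j
    exact hU i j
  obtain rfl : s = σ ∘ Fin.castAdd q := funext hs
  have hcast : Function.Injective (Fin.castAdd q : Fin k → Fin (k + q)) := Fin.castAdd_injective k q
  refine ⟨hUJ ▸ transpose_submatrix_mul_self hsvd.left_orthonormal hcast,
    V'.submatrix id (Fin.castAdd q), transpose_submatrix_mul_self hsvd.right_orthonormal hcast,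
    hUJ ▸ hsvd.mul_submatrix _, ?_⟩
  have e : R * (1 - V'.submatrix id (Fin.castAdd q) * (V'.submatrix id (Fin.castAdd q))ᵀ)
      = U' * (Matrix.diagonal (fun i : Fin (k + q) => if (i : ℕ) < k then 0 else σ i) * V'ᵀ) := by
    rw [Matrix.mul_sub, Matrix.mul_one, ← Matrix.mul_assoc, hsvd.mul_submatrix, hsvd.eq]
    ext i j
    simp [Matrix.mul_apply, Matrix.diagonal_apply, Fin.sum_univ_add, mul_assoc]
  intro x
  rw [e, ← Matrix.mulVec_mulVec, dotProduct_mulVec_self_of_orthonormal hsvd.left_orthonormal,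
    ← Matrix.mulVec_mulVec]
  refine le_trans ?_ (mul_le_mul_of_nonneg_left
    (dotProduct_transpose_mulVec_le hsvd.right_orthonormal x) hc)
  generalize V'ᵀ *ᵥ x = y
  simp only [dotProduct, Finset.mul_sum, Matrix.mulVec_diagonal]
  refine Finset.sum_le_sum fun i _ => ?_
  split_ifs with hi
  · simpa using mul_nonneg hc (mul_self_nonneg (y i))
  · nlinarith [mul_le_mul_of_nonneg_right (hsvd.sq_le_of_opBound hrk hE i (not_lt.1 hi))
      (mul_self_nonneg (y i))]

end Singular

/-! ### Rotations of the factors, for a given sample -/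

section Rotation

variable {α β : Type*} [Fintype α] [Fintype β] {r k : ℕ}

/-- The bounds of `ProxyRate` in one sample, with constant `C`. -/
def RotationBound (F : Matrix α (Fin k) ℝ) (φ : Matrix α (Fin r) ℝ) (n a C : ℝ) : Prop :=
  ∃ (H : Matrix (Fin r) (Fin k) ℝ) (G : Matrix (Fin k) (Fin r) ℝ),
    frobSq H ≤ C ∧ frobSq G ≤ C ∧ H * G = 1 ∧ n⁻¹ * frobSq (F - φ * H) ≤ C * a ∧
      n⁻¹ * frobSq (F * G - φ) ≤ C * a

theorem RotationBound.mono {F : Matrix α (Fin k) ℝ} {φ : Matrix α (Fin r) ℝ} {n a C C' : ℝ}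
    (h : RotationBound F φ n a C) (ha : 0 ≤ a) (hC : C ≤ C') : RotationBound F φ n a C' := by
  obtain ⟨H, G, h1, h2, h3, h4, h5⟩ := h
  have := mul_le_mul_of_nonneg_right hC ha
  exact ⟨H, G, h1.trans hC, h2.trans hC, h3, h4.trans this, h5.trans this⟩

/-- The constant of `rotationBound_score`. -/
def scoreConst (M : ℝ) (r k : ℕ) : ℝ := M * k * (4 * r * k * M) + M * k + 4 * r * k * M

theorem rotationBound_score [DecidableEq β] (hrk : r ≤ k) {n₁ n₂ M : ℝ} (hn₁ : 0 < n₁)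
    (hn₂ : 0 < n₂) (hM : 0 ≤ M) {φ : Matrix α (Fin r) ℝ} {ψ : Matrix (Fin r) α ℝ}
    {Γ Z : Matrix β (Fin r) ℝ} {R : Matrix α β ℝ} {U : Matrix α (Fin k) ℝ} {s : Fin k → ℝ}
    (hψφ : ψ * φ = 1) (hΓZ : Γᵀ * Z = 1) (hψ : frobSq ψ ≤ M / n₁) (hΓ : frobSq Γ ≤ M * n₂)
    (hZ : frobSq Z ≤ M / n₂) (hE : OpBound (R - φ * Γᵀ) (M * max n₁ n₂))
    (hR : IsLeadingSVD R U s) (hlarge : 16 * M ^ 3 ≤ min n₁ n₂) :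
    RotationBound ((Real.sqrt n₂)⁻¹ • (U * Matrix.diagonal s)) φ n₁ (1 / min n₁ n₂)
      (scoreConst M r k) := by
  have hmax : 0 < max n₁ n₂ := lt_max_of_lt_left hn₁
  have hmin : 0 < min n₁ n₂ := lt_min hn₁ hn₂
  have hmm : max n₁ n₂ * min n₁ n₂ = n₁ * n₂ := max_mul_min n₁ n₂
  have hc : 0 ≤ M * max n₁ n₂ := mul_nonneg hM hmax.le
  obtain ⟨-, V, hV, hRV, hrem⟩ := hR.exists_right hrk hc hE
  set E := R - φ * Γᵀ with hEdef
  have hVk : frobSq V = k := by rw [frobSq_of_orthonormal hV, Fintype.card_fin]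
  have hVk' : frobSq Vᵀ = k := by rw [frobSq_transpose, hVk]
  set p : Matrix β β ℝ := 1 - V * Vᵀ with hp
  have hVp : OpBound p 1 := by
    intro x
    have h1 : p *ᵥ x = x - V *ᵥ (Vᵀ *ᵥ x) := by
      rw [hp, Matrix.sub_mulVec, Matrix.one_mulVec, Matrix.mulVec_mulVec]
    have h2 : x ⬝ᵥ V *ᵥ (Vᵀ *ᵥ x) = Vᵀ *ᵥ x ⬝ᵥ Vᵀ *ᵥ x := by
      rw [Matrix.dotProduct_mulVec, ← Matrix.mulVec_transpose]
    rw [h1, sub_dotProduct, dotProduct_sub, dotProduct_sub,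
      dotProduct_mulVec_self_of_orthonormal hV, dotProduct_comm (V *ᵥ _) x, h2]
    linarith [dotProduct_self_nonneg' (Vᵀ *ᵥ x)]
  have hEp : OpBound (E * p) (M * max n₁ n₂) := by
    intro x
    rw [← Matrix.mulVec_mulVec]
    refine (hE _).trans (mul_le_mul_of_nonneg_left ?_ hc)
    simpa using hVp x
  have hAp : OpBound (φ * Γᵀ * p) (4 * (M * max n₁ n₂)) := by
    have e : φ * Γᵀ * p = R * p - E * p := by
      rw [← Matrix.sub_mul, hEdef, sub_sub_cancel]
    rw [e]
    exact (hrem.sub hEp).mono (by linarith)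
  set D : Matrix (Fin r) (Fin r) ℝ := Γᵀ * p * Z with hD
  have hDψ : D = ψ * (φ * Γᵀ * p * Z) := by
    rw [hD, ← Matrix.one_mul (Γᵀ * p * Z), ← hψφ]
    simp only [Matrix.mul_assoc]
  have hDle : frobSq D ≤ 1 / 4 := by
    have h1 : frobSq D ≤ M / n₁ * (4 * (M * max n₁ n₂) * (M / n₂)) := by
      rw [hDψ]
      refine (frobSq_mul_le _ _).trans (mul_le_mul hψ ?_ (frobSq_nonneg _) (by positivity))
      exact (hAp.frobSq_mul_le Z).trans (mul_le_mul_of_nonneg_left hZ (by positivity))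
    refine h1.trans ?_
    have h2 : M / n₁ * (4 * (M * max n₁ n₂) * (M / n₂)) = 4 * M ^ 3 / min n₁ n₂ := by
      rw [eq_div_iff hmin.ne']
      field_simp
      linear_combination M ^ 3 * hmm
    rw [h2, div_le_iff₀ hmin]
    linarith
  obtain ⟨J, hJ, hJr⟩ := exists_inv_one_sub D hDle
  set q := Real.sqrt n₂ with hq
  have hq0 : 0 < q := Real.sqrt_pos.2 hn₂
  have hqq : q ^ 2 = n₂ := Real.sq_sqrt hn₂.le
  have hHG : (q⁻¹ • (Γᵀ * V)) * (q • (Vᵀ * Z * J)) = 1 := by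
    rw [Matrix.smul_mul, Matrix.mul_smul, smul_smul, inv_mul_cancel₀ hq0.ne', one_smul, ← hJ]
    have : Γᵀ * V * (Vᵀ * Z * J) = Γᵀ * (1 - p) * Z * J := by
      rw [hp, sub_sub_cancel]
      simp only [Matrix.mul_assoc]
    rw [this, Matrix.mul_sub, Matrix.mul_one, Matrix.sub_mul, hΓZ]
  have hFH : q⁻¹ • (U * Matrix.diagonal s) - φ * (q⁻¹ • (Γᵀ * V)) = q⁻¹ • (E * V) := by
    rw [Matrix.mul_smul, ← smul_sub, ← hRV, ← Matrix.mul_assoc, ← Matrix.sub_mul]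
  have hFG : q⁻¹ • (U * Matrix.diagonal s) * (q • (Vᵀ * Z * J)) - φ
      = q⁻¹ • (E * V) * (q • (Vᵀ * Z * J)) := by
    rw [← hFH, Matrix.sub_mul, Matrix.mul_assoc φ, hHG, Matrix.mul_one]
  have hH : frobSq (q⁻¹ • (Γᵀ * V)) ≤ M * k := by
    rw [frobSq_smul, inv_pow, hqq, inv_mul_le_iff₀ hn₂]
    refine (frobSq_mul_le _ _).trans ?_
    rw [frobSq_transpose, hVk]
    nlinarith [mul_le_mul_of_nonneg_right hΓ (Nat.cast_nonneg (α := ℝ) k)]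
  have hG : frobSq (q • (Vᵀ * Z * J)) ≤ 4 * r * k * M := by
    rw [frobSq_smul, hqq]
    have h1 : frobSq (Vᵀ * Z * J) ≤ k * (M / n₂) * (4 * r) := by
      refine (frobSq_mul_le _ _).trans (mul_le_mul ?_ hJr (frobSq_nonneg _) (by positivity))
      refine (frobSq_mul_le _ _).trans ?_
      rw [hVk']
      exact mul_le_mul_of_nonneg_left hZ (by positivity)
    calc n₂ * frobSq (Vᵀ * Z * J) ≤ n₂ * (k * (M / n₂) * (4 * r)) :=
          mul_le_mul_of_nonneg_left h1 hn₂.le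
      _ = 4 * r * k * M := by field_simp
  have hEV : n₁⁻¹ * frobSq (q⁻¹ • (E * V)) ≤ M * k * (1 / min n₁ n₂) := by
    rw [frobSq_smul, inv_pow, hqq]
    have h1 : frobSq (E * V) ≤ M * max n₁ n₂ * k := hVk ▸ hE.frobSq_mul_le V
    calc n₁⁻¹ * (n₂⁻¹ * frobSq (E * V)) ≤ n₁⁻¹ * (n₂⁻¹ * (M * max n₁ n₂ * k)) := by gcongr
      _ = M * k * (1 / min n₁ n₂) := by
          have : max n₁ n₂ = n₁ * n₂ / min n₁ n₂ := by rw [eq_div_iff hmin.ne', hmm]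
          rw [this]
          field_simp
  have ha : 0 ≤ 1 / min n₁ n₂ := by positivity
  have e1 : 0 ≤ M * k := by positivity
  have e2 : 0 ≤ 4 * r * k * M := by positivity
  have e3 := mul_nonneg e1 e2
  refine ⟨q⁻¹ • (Γᵀ * V), q • (Vᵀ * Z * J), ?_, ?_, hHG, ?_, ?_⟩
  · unfold scoreConst; linarith
  · unfold scoreConst; linarith
  · rw [hFH]
    refine hEV.trans (mul_le_mul_of_nonneg_right ?_ ha)
    unfold scoreConst; linarith
  · rw [hFG]
    calc n₁⁻¹ * frobSq (q⁻¹ • (E * V) * (q • (Vᵀ * Z * J)))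
        ≤ n₁⁻¹ * (frobSq (q⁻¹ • (E * V)) * frobSq (q • (Vᵀ * Z * J))) := by
          gcongr
          exact frobSq_mul_le _ _
      _ ≤ M * k * (1 / min n₁ n₂) * (4 * r * k * M) := by
          rw [← mul_assoc]
          exact mul_le_mul hEV hG (frobSq_nonneg _) (by positivity)
      _ = M * k * (4 * r * k * M) * (1 / min n₁ n₂) := by ring
      _ ≤ _ := by
          refine mul_le_mul_of_nonneg_right ?_ ha
          unfold scoreConst; linarith

/-- The constant of `RotationBound.unit`. -/
def unitConst (C M : ℝ) (r : ℕ) : ℝ :=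
  C * (C * (4 * r) * (M * r)) + r * (2 * C + 2 * (M * C)) * C + C

theorem RotationBound.unit {n a C M : ℝ} (hn : 0 < n) (ha : 0 ≤ a) (ha1 : a ≤ 1) (hM : 0 ≤ M)
    {U : Matrix α (Fin r) ℝ} {T : Matrix (Fin r) (Fin r) ℝ} {φ : Matrix α (Fin r) ℝ}
    {ψ : Matrix (Fin r) α ℝ} (hψφ : ψ * φ = 1) (hψ : frobSq ψ ≤ M / n) (hφ : frobSq φ ≤ M * n)
    (hU : Uᵀ * U = 1) (h : RotationBound (Real.sqrt n • (U * T)) φ n a C)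
    (hsmall : M * C * a ≤ 1 / 4) :
    RotationBound (Real.sqrt n • U) φ n a (unitConst C M r) := by
  obtain ⟨H, G, hH, hG, hHG, hFH, hFG⟩ := h
  have hC : 0 ≤ C := (frobSq_nonneg _).trans hH
  set q := Real.sqrt n with hq
  have hq0 : 0 < q := Real.sqrt_pos.2 hn
  have hqq : q ^ 2 = n := Real.sq_sqrt hn.le
  set F := q • (U * T) with hF
  have hUr : frobSq U = r := by rw [frobSq_of_orthonormal hU, Fintype.card_fin]
  have hUr' : frobSq Uᵀ = r := by rw [frobSq_transpose, hUr]
  rw [inv_mul_le_iff₀ hn] at hFH hFG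
  have hD : frobSq (-(ψ * (F * G - φ))) ≤ 1 / 4 := by
    rw [frobSq_neg]
    calc frobSq (ψ * (F * G - φ)) ≤ M / n * (n * (C * a)) :=
          (frobSq_mul_le _ _).trans (mul_le_mul hψ hFG (frobSq_nonneg _) (by positivity))
      _ = M * C * a := by field_simp
      _ ≤ 1 / 4 := hsmall
  obtain ⟨J, hJ, hJr⟩ := exists_inv_one_sub _ hD
  rw [sub_neg_eq_add, Matrix.mul_sub, hψφ, add_sub_cancel] at hJ
  set W := G * J * (q • (ψ * U)) with hW
  have hTW : T * W = 1 := by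
    have h1 : (q • (ψ * U)) * (T * G * J) = 1 := by
      rw [← hJ, hF]
      simp only [Matrix.smul_mul, Matrix.mul_smul, Matrix.mul_assoc]
    have h2 := mul_eq_one_comm.1 h1
    rw [← h2, hW]
    simp only [Matrix.mul_assoc]
  have hWT : W * T = 1 := mul_eq_one_comm.1 hTW
  have hWle : frobSq W ≤ C * (4 * r) * (M * r) := by
    refine (frobSq_mul_le _ _).trans (mul_le_mul ?_ ?_ (frobSq_nonneg _) (by positivity))
    · exact (frobSq_mul_le _ _).trans (mul_le_mul hG hJr (frobSq_nonneg _) hC)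
    · rw [frobSq_smul, hqq]
      calc n * frobSq (ψ * U) ≤ n * (M / n * r) := by
            refine mul_le_mul_of_nonneg_left ((frobSq_mul_le _ _).trans ?_) hn.le
            rw [hUr]
            exact mul_le_mul_of_nonneg_right hψ (by positivity)
        _ = M * r := by field_simp
  have hFW : q • U = F * W := by
    rw [hF, Matrix.smul_mul, Matrix.mul_assoc, hTW, Matrix.mul_one]
  have hFle : frobSq F ≤ n * (2 * C + 2 * (M * C)) := by
    have h1 := frobSq_add_le (F - φ * H) (φ * H)
    rw [sub_add_cancel] at h1
    have h2 : frobSq (φ * H) ≤ M * n * C :=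
      (frobSq_mul_le _ _).trans (mul_le_mul hφ hH (frobSq_nonneg _) (by positivity))
    have h3 : n * (C * a) ≤ n * C :=
      mul_le_mul_of_nonneg_left (mul_le_of_le_one_right hC ha1) hn.le
    nlinarith
  have hT : frobSq T ≤ r * (2 * C + 2 * (M * C)) := by
    have e : T = q⁻¹ • (Uᵀ * F) := by
      rw [hF, Matrix.mul_smul, smul_smul, inv_mul_cancel₀ hq0.ne', one_smul, ← Matrix.mul_assoc,
        hU, Matrix.one_mul]
    rw [e, frobSq_smul, inv_pow, hqq, inv_mul_le_iff₀ hn]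
    refine (frobSq_mul_le _ _).trans ?_
    rw [hUr']
    calc (r : ℝ) * frobSq F ≤ r * (n * (2 * C + 2 * (M * C))) := by gcongr
      _ = _ := by ring
  have e1 : 0 ≤ C * (C * (4 * r) * (M * r)) := by positivity
  have e2 : 0 ≤ r * (2 * C + 2 * (M * C)) * C := by positivity
  have hle : ∀ x y : ℝ, x ≤ y * (C * a) → 0 ≤ y → y * C ≤ unitConst C M r →
      x ≤ unitConst C M r * a := fun x y h1 h2 h3 => by
    nlinarith [mul_le_mul_of_nonneg_right h3 ha]
  refine ⟨H * W, T * G, ?_, ?_, ?_, ?_, ?_⟩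
  · refine (frobSq_mul_le _ _).trans ((mul_le_mul hH hWle (frobSq_nonneg _) hC).trans ?_)
    unfold unitConst; linarith
  · refine (frobSq_mul_le _ _).trans ((mul_le_mul hT hG (frobSq_nonneg _) (by positivity)).trans ?_)
    unfold unitConst; linarith
  · rw [Matrix.mul_assoc, ← Matrix.mul_assoc W, hWT, Matrix.one_mul, hHG]
  · rw [hFW, ← Matrix.mul_assoc φ, ← Matrix.sub_mul]
    refine hle _ (C * (4 * r) * (M * r)) ?_ (by positivity) ?_
    · rw [inv_mul_le_iff₀ hn]
      refine (frobSq_mul_le _ _).trans ((mul_le_mul hFH hWle (frobSq_nonneg _) (by positivity)).trans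
        (le_of_eq (by ring)))
    · unfold unitConst; linarith
  · have e : q • U * (T * G) = F * G := by
      rw [hF, Matrix.smul_mul, Matrix.smul_mul, Matrix.mul_assoc]
    rw [e]
    refine hle _ 1 ?_ zero_le_one ?_
    · rw [inv_mul_le_iff₀ hn, one_mul]
      exact hFG
    · unfold unitConst; linarith

end Rotation

/-! ### Slope estimates, for a given sample -/

section Projection

variable {α β : Type*} [Fintype α] [Fintype β]

theorem frobSq_sub_le_weighted {γ : Type*} [Fintype γ] (A B : Matrix α γ ℝ) {t : ℝ} (ht : 0 < t) :
    frobSq (A - B) ≤ (1 + 1 / t) * frobSq A + (1 + t) * frobSq B := by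
  simp only [frobSq, Finset.mul_sum, ← Finset.sum_add_distrib]
  refine Finset.sum_le_sum fun i _ => Finset.sum_le_sum fun j _ => ?_
  rw [Matrix.sub_apply]
  have h : (1 + 1 / t) * A i j ^ 2 + (1 + t) * B i j ^ 2 - (A i j - B i j) ^ 2
      = (A i j + t * B i j) ^ 2 / t := by
    field_simp
    ring
  have := div_nonneg (sq_nonneg (A i j + t * B i j)) ht.le
  linarith

theorem frobSq_sub_eq (A B : Matrix α β ℝ) :
    frobSq (A - B) = frobSq A - 2 * ∑ i, ∑ j, B i j * A i j + frobSq B := by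
  simp only [frobSq, Finset.mul_sum, ← Finset.sum_add_distrib, ← Finset.sum_sub_distrib]
  refine Finset.sum_congr rfl fun i _ => Finset.sum_congr rfl fun j _ => ?_
  rw [Matrix.sub_apply]
  ring

variable [DecidableEq β]

theorem frobSq_eq_add_of_orthonormal {k : ℕ} (A : Matrix α β ℝ) {Q : Matrix β (Fin k) ℝ}
    (hQ : Qᵀ * Q = 1) : frobSq A = frobSq (A * (1 - Q * Qᵀ)) + frobSq (A * Q) := by
  have h1 : (1 - Q * Qᵀ) * (1 - Q * Qᵀ)ᵀ = 1 - Q * Qᵀ := by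
    have hQQ : Q * Qᵀ * (Q * Qᵀ) = Q * Qᵀ := by
      rw [Matrix.mul_assoc, ← Matrix.mul_assoc Qᵀ, hQ, Matrix.one_mul]
    rw [Matrix.transpose_sub, Matrix.transpose_one, Matrix.transpose_mul,
      Matrix.transpose_transpose, Matrix.sub_mul, Matrix.mul_sub, Matrix.mul_sub, hQQ]
    simp
  have h2 : A * (1 - Q * Qᵀ) * (A * (1 - Q * Qᵀ))ᵀ = A * Aᵀ - A * Q * (A * Q)ᵀ := by
    rw [Matrix.transpose_mul, Matrix.mul_assoc, ← Matrix.mul_assoc (1 - Q * Qᵀ), h1,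
      Matrix.sub_mul, Matrix.mul_sub, Matrix.one_mul, Matrix.transpose_mul]
    simp only [Matrix.mul_assoc]
  rw [frobSq_eq_trace', frobSq_eq_trace', frobSq_eq_trace', h2, Matrix.trace_sub]
  ring

/-- The basic inequality of least squares with `k` factors: `S` is the change in the fitted values,
`e` the error and `τ` a lower bound for what is left of `S` after projecting out factors. -/
theorem tail_le_of_objective_le {r k : ℕ} {S e : Matrix α β ℝ} {φ : Matrix α (Fin r) ℝ}
    {Γ : Matrix β (Fin r) ℝ} {c τ t : ℝ} (ht : 0 < t) (hc : 0 ≤ c) (he : OpBound e c)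
    (hτ : ∀ j ≤ r + k, ∀ Q : Matrix β (Fin j) ℝ, Qᵀ * Q = 1 → τ ≤ frobSq (S * (1 - Q * Qᵀ)))
    (hle : ⨅ p : Matrix α (Fin k) ℝ × Matrix β (Fin k) ℝ, frobSq (φ * Γᵀ + e - S - p.1 * p.2ᵀ)
      ≤ frobSq e) :
    τ ≤ 2 * (∑ i, ∑ j, S i j * e i j) + t * frobSq S + (1 + 1 / t) * ((r + k) * c) := by
  have key : ∀ p : Matrix α (Fin k) ℝ × Matrix β (Fin k) ℝ,
      frobSq e - 2 * (∑ i, ∑ j, S i j * e i j) + τ - t * frobSq S - (1 + 1 / t) * ((r + k) * c)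
        ≤ frobSq (φ * Γᵀ + e - S - p.1 * p.2ᵀ) := by
    rintro ⟨F, G⟩
    obtain ⟨j, hj, Q, hQ, hQC⟩ := exists_orthonormal_columns (Matrix.fromCols Γ G)
    have hj' : j ≤ r + k := by simpa using hj
    rw [Matrix.mul_fromCols, Matrix.fromCols_inj.eq_iff] at hQC
    have hkill : ∀ {q : ℕ} (W : Matrix β (Fin q) ℝ), Q * Qᵀ * W = W →
        Wᵀ * (1 - Q * Qᵀ) = 0 := by
      intro q W hW
      have := congrArg Matrix.transpose hW
      rw [Matrix.transpose_mul, Matrix.transpose_mul, Matrix.transpose_transpose] at this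
      rw [Matrix.mul_sub, Matrix.mul_one, this, sub_self]
    have e1 : (φ * Γᵀ + e - S - F * Gᵀ) * (1 - Q * Qᵀ) = (e - S) * (1 - Q * Qᵀ) := by
      have : φ * Γᵀ + e - S - F * Gᵀ = φ * Γᵀ + (e - S) - F * Gᵀ := by abel
      rw [this, Matrix.sub_mul, Matrix.add_mul, Matrix.mul_assoc, Matrix.mul_assoc F,
        hkill Γ hQC.1, hkill G hQC.2]
      simp
    have h1 := frobSq_eq_add_of_orthonormal (φ * Γᵀ + e - S - F * Gᵀ) hQ
    rw [e1] at h1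
    have h2 := frobSq_eq_add_of_orthonormal (e - S) hQ
    have h3 := frobSq_eq_add_of_orthonormal S hQ
    have h4 := frobSq_sub_eq e S
    have h5 := frobSq_sub_le_weighted (e * Q) (S * Q) ht
    rw [← Matrix.sub_mul] at h5
    have h6 := hτ j hj' Q hQ
    have h7 : frobSq (e * Q) ≤ (r + k) * c := by
      refine (he.frobSq_mul_le Q).trans ?_
      rw [frobSq_of_orthonormal hQ, Fintype.card_fin, mul_comm]
      exact mul_le_mul_of_nonneg_right (by exact_mod_cast hj') hc
    have h8 : (1 + 1 / t) * frobSq (e * Q) ≤ (1 + 1 / t) * ((r + k) * c) :=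
      mul_le_mul_of_nonneg_left h7 (by positivity)
    have h9 : t * frobSq (S * Q) ≤ t * frobSq S :=
      mul_le_mul_of_nonneg_left (by linarith [frobSq_nonneg (S * (1 - Q * Qᵀ))]) ht.le
    have h10 := frobSq_nonneg ((φ * Γᵀ + e - S - F * Gᵀ) * Q)
    linarith
  linarith [(le_ciInf key).trans hle]

end Projection

section Flatten

variable {d : ℕ} {N : Fin d → ℕ}

theorem sum_flatten (n : Fin d) (f : (∀ k, Fin (N k)) → ℝ) :
    ∑ i, ∑ j, f ((Equiv.piSplitAt n fun k => Fin (N k)).symm (i, j)) = ∑ i, f i := by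
  rw [← Fintype.sum_prod_type' fun i j => f ((Equiv.piSplitAt n fun k => Fin (N k)).symm (i, j))]
  exact Equiv.sum_comp (Equiv.piSplitAt n fun k => Fin (N k)).symm f

theorem frobSq_flatten (n : Fin d) (T : Tensor N) : frobSq (flatten n T) = ∑ i, T i ^ 2 :=
  sum_flatten n fun i => T i ^ 2

theorem sum_flatten_mul (n : Fin d) (T T' : Tensor N) :
    ∑ i, ∑ j, flatten n T i j * flatten n T' i j = ∑ i, T i * T' i :=
  sum_flatten n fun i => T i * T' i

theorem residual_outcome {K L : ℕ} (n : Fin d) (X : Fin K → Tensor N) (β b : Fin K → ℝ)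
    (Φ : ∀ n, Matrix (Fin (N n)) (Fin L) ℝ) (ε : Tensor N) :
    residual n (outcome X β Φ ε) X b
      = flatten n (interactive Φ) + flatten n ε - flatten n (lin X (b - β)) := by
  ext i j
  simp only [residual, flatten, outcome, lin, Matrix.add_apply, Matrix.sub_apply, Pi.sub_apply,
    mul_sub, Finset.sum_sub_distrib]
  ring

theorem sum_lin_sq_le {K : ℕ} {X : Fin K → Tensor N} {M T : ℝ} (hX : ∀ k, ∑ i, X k i ^ 2 ≤ M * T)
    (δ : Fin K → ℝ) : ∑ i, lin X δ i ^ 2 ≤ K * M * (T * ∑ k, δ k ^ 2) := by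
  calc ∑ i, lin X δ i ^ 2 ≤ ∑ i, (∑ k, X k i ^ 2) * ∑ k, δ k ^ 2 :=
        Finset.sum_le_sum fun i _ => Finset.sum_mul_sq_le_sq_mul_sq _ _ _
    _ = (∑ k, ∑ i, X k i ^ 2) * ∑ k, δ k ^ 2 := by rw [← Finset.sum_mul, Finset.sum_comm]
    _ ≤ (∑ _k : Fin K, M * T) * ∑ k, δ k ^ 2 :=
        mul_le_mul_of_nonneg_right (Finset.sum_le_sum fun k _ => hX k)
          (Finset.sum_nonneg fun _ _ => sq_nonneg _)
    _ = K * M * (T * ∑ k, δ k ^ 2) := by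
        rw [Finset.sum_const, Finset.card_univ, Fintype.card_fin, nsmul_eq_mul]
        ring

theorem two_mul_sum_lin_mul_le {K : ℕ} {X : Fin K → Tensor N} {ε : Tensor N} {M T t : ℝ}
    (hT : 0 < T) (ht : 0 < t) (hX : ∀ k, (∑ i, X k i * ε i) ^ 2 ≤ M * T) (δ : Fin K → ℝ) :
    2 * ∑ i, lin X δ i * ε i ≤ t * (T * ∑ k, δ k ^ 2) + K * M / t := by
  have e : ∑ i, lin X δ i * ε i = ∑ k, δ k * ∑ i, X k i * ε i := by
    simp only [lin, Finset.sum_mul, Finset.mul_sum]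
    rw [Finset.sum_comm]
    exact Finset.sum_congr rfl fun _ _ => Finset.sum_congr rfl fun _ _ => by ring
  have e2 : t * (T * ∑ k, δ k ^ 2) + K * M / t = ∑ k, (t * T * δ k ^ 2 + M / t) := by
    rw [Finset.sum_add_distrib, ← Finset.mul_sum, Finset.sum_const, Finset.card_univ,
      Fintype.card_fin, nsmul_eq_mul]
    ring
  rw [e, e2, Finset.mul_sum]
  refine Finset.sum_le_sum fun k _ => ?_
  have h1 : (∑ i, X k i * ε i) ^ 2 / (t * T) ≤ M / t := by
    rw [div_le_div_iff₀ (mul_pos ht hT) ht]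
    nlinarith [mul_le_mul_of_nonneg_left (hX k) ht.le]
  have h2 : t * T * δ k ^ 2 + (∑ i, X k i * ε i) ^ 2 / (t * T) - 2 * (δ k * ∑ i, X k i * ε i)
      = (t * T * δ k - ∑ i, X k i * ε i) ^ 2 / (t * T) := by
    field_simp
    ring
  have := div_nonneg (sq_nonneg (t * T * δ k - ∑ i, X k i * ε i)) (mul_pos ht hT).le
  linarith

/-- The constant of `slope_sq_le`. -/
noncomputable def slopeConst (K : ℕ) (κ M c : ℝ) : ℝ :=
  2 / c * (4 * (K * M) / c + (1 + 4 * (K * M + 1) / c) * (κ * M))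

theorem slope_sq_le {K L r k : ℕ} {n : Fin d} {X : Fin K → Tensor N} {β b : Fin K → ℝ}
    {Φ : ∀ n, Matrix (Fin (N n)) (Fin L) ℝ} {ε : Tensor N} {φ : Matrix (Fin (N n)) (Fin r) ℝ}
    {Γ : Matrix (CoIndex N n) (Fin r) ℝ} {M T v c : ℝ} (hM : 0 ≤ M) (hT : 0 < T) (hv : 1 ≤ v)
    (hc : 0 < c) (hrk : r ≤ k) (hA : flatten n (interactive Φ) = φ * Γᵀ)
    (hX : ∀ k, ∑ i, X k i ^ 2 ≤ M * T) (hXε : ∀ k, (∑ i, X k i * ε i) ^ 2 ≤ M * T)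
    (hε : OpBound (flatten n ε) (M * v))
    (hns : ∀ δ : Fin K → ℝ, ∑ k, δ k ^ 2 = 1 →
      c < ∑ s ∈ Finset.Ico (r + k) (min (N n) (Fintype.card (CoIndex N n))),
        singVal ((Real.sqrt T)⁻¹ • flatten n (lin X δ)) s ^ 2)
    (hle : profileObjective n k (outcome X β Φ ε) X b
      ≤ profileObjective n k (outcome X β Φ ε) X β) :
    T * ∑ k, (b - β) k ^ 2 ≤ slopeConst K (r + k) M c * v := by
  set δ := b - β with hδ
  set D := ∑ k, δ k ^ 2 with hD
  have hD0 : 0 ≤ D := Finset.sum_nonneg fun _ _ => sq_nonneg _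
  have hτ : ∀ j ≤ r + k, ∀ Q : Matrix (CoIndex N n) (Fin j) ℝ, Qᵀ * Q = 1 →
      c * (T * D) ≤ frobSq (flatten n (lin X δ) * (1 - Q * Qᵀ)) := by
    intro j hj Q hQ
    rcases hD0.eq_or_lt with h0 | h0
    · rw [← h0, mul_zero, mul_zero]
      exact frobSq_nonneg _
    · set q := Real.sqrt D
      have hq : 0 < q := Real.sqrt_pos.2 h0
      have hqq : q ^ 2 = D := Real.sq_sqrt h0.le
      have h1 := hns (q⁻¹ • δ) (by
        simp only [Pi.smul_apply, smul_eq_mul, mul_pow, ← Finset.mul_sum]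
        rw [inv_pow, hqq]
        exact inv_mul_cancel₀ h0.ne')
      have h2 := h1.le.trans (sum_sq_singVal_le _ hj (min_le_right _ _) Q hQ)
      have e : flatten n (lin X (q⁻¹ • δ)) = q⁻¹ • flatten n (lin X δ) := by
        ext i j
        simp only [flatten, lin, Pi.smul_apply, smul_eq_mul, Matrix.smul_apply, Finset.mul_sum]
        exact Finset.sum_congr rfl fun _ _ => by ring
      rw [e, Matrix.smul_mul, Matrix.smul_mul, frobSq_smul, frobSq_smul, inv_pow, inv_pow, hqq,
        Real.sq_sqrt hT.le, ← mul_assoc, ← mul_inv, le_inv_mul_iff₀ (mul_pos hT h0)] at h2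
      linarith
  have hobj : ⨅ p : Matrix (Fin (N n)) (Fin k) ℝ × Matrix (CoIndex N n) (Fin k) ℝ,
      frobSq (φ * Γᵀ + flatten n ε - flatten n (lin X δ) - p.1 * p.2ᵀ) ≤ frobSq (flatten n ε) := by
    simp only [profileObjective, residual_outcome, hA] at hle
    refine hle.trans ?_
    obtain ⟨q, rfl⟩ := Nat.exists_eq_add_of_le hrk
    have hbdd : BddBelow (Set.range fun p : Matrix (Fin (N n)) (Fin (r + q)) ℝ ×
        Matrix (CoIndex N n) (Fin (r + q)) ℝ =>
        frobSq (φ * Γᵀ + flatten n ε - flatten n (lin X (β - β)) - p.1 * p.2ᵀ)) :=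
      ⟨0, by rintro _ ⟨p, rfl⟩; exact frobSq_nonneg _⟩
    refine (ciInf_le hbdd (Matrix.of fun i => Fin.append (φ i) 0,
      Matrix.of fun i => Fin.append (Γ i) 0)).trans (le_of_eq ?_)
    congr 1
    ext i j
    simp [Matrix.mul_apply, Fin.sum_univ_add, flatten, lin]
  have main := tail_le_of_objective_le (t := c / (4 * (K * M + 1))) (by positivity)
    (by positivity) hε hτ hobj
  rw [sum_flatten_mul, frobSq_flatten] at main
  have h1 := two_mul_sum_lin_mul_le hT (show 0 < c / 4 by positivity) hXε δ
  have h2 : c / (4 * (K * M + 1)) * ∑ i, lin X δ i ^ 2 ≤ c / 4 * (T * D) := by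
    have hKM : 0 ≤ (K : ℝ) * M := by positivity
    calc c / (4 * (K * M + 1)) * ∑ i, lin X δ i ^ 2
        ≤ c / (4 * (K * M + 1)) * (K * M * (T * D)) := by
          gcongr
          exact sum_lin_sq_le hX δ
      _ ≤ c / (4 * (K * M + 1)) * ((K * M + 1) * (T * D)) := by
          gcongr
          linarith
      _ = c / 4 * (T * D) := by field_simp
  have h3 : c / 2 * (T * D) ≤ 4 * (K * M) / c + (1 + 4 * (K * M + 1) / c) * ((r + k) * (M * v)) := by
    have e1 : (K : ℝ) * M / (c / 4) = 4 * (K * M) / c := by field_simp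
    have e2 : 1 / (c / (4 * ((K : ℝ) * M + 1))) = 4 * (K * M + 1) / c := by
      rw [one_div_div]
    rw [e1] at h1
    rw [e2] at main
    linarith
  have h4 : 4 * (K * M) / c ≤ 4 * (K * M) / c * v :=
    le_mul_of_one_le_right (by positivity) hv
  have h5 : c / 2 * (T * D)
      ≤ (4 * (K * M) / c + (1 + 4 * (K * M + 1) / c) * ((r + k) * M)) * v := by
    linarith
  calc T * D = 2 / c * (c / 2 * (T * D)) := by field_simp
    _ ≤ 2 / c * ((4 * (K * M) / c + (1 + 4 * (K * M + 1) / c) * ((r + k) * M)) * v) := by gcongr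
    _ = slopeConst K (r + k) M c * v := by unfold slopeConst; ring

/-- The operator norm of the residual less the interactive effect. -/
theorem opBound_residual {K L r : ℕ} {n : Fin d} {X : Fin K → Tensor N} {β b : Fin K → ℝ}
    {Φ : ∀ n, Matrix (Fin (N n)) (Fin L) ℝ} {ε : Tensor N} {φ : Matrix (Fin (N n)) (Fin r) ℝ}
    {Γ : Matrix (CoIndex N n) (Fin r) ℝ} {M T v C : ℝ} (hM : 0 ≤ M)
    (hA : flatten n (interactive Φ) = φ * Γᵀ) (hX : ∀ k, ∑ i, X k i ^ 2 ≤ M * T)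
    (hε : OpBound (flatten n ε) (M * v)) (hb : T * ∑ k, (b - β) k ^ 2 ≤ C * v) :
    OpBound (residual n (outcome X β Φ ε) X b - φ * Γᵀ) ((2 * M + 2 * (K * M * C)) * v) := by
  rw [residual_outcome, hA, add_sub_assoc, add_sub_cancel_left]
  refine (hε.sub (opBound_frobSq _)).mono ?_
  rw [frobSq_flatten]
  have h := (sum_lin_sq_le hX (b - β)).trans
    (mul_le_mul_of_nonneg_left hb (by positivity : (0 : ℝ) ≤ K * M))
  linarith

end Flatten

/-! ### Flattenings of the interactive effect -/

section Interactive

variable {d L : ℕ} {a b c : Fin d → ℕ}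

/-- The Kronecker product of all matrices of a family but the `n`-th. -/
def coProd (n : Fin d) (A : ∀ k, Matrix (Fin (a k)) (Fin (b k)) ℝ) :
    Matrix (CoIndex a n) (CoIndex b n) ℝ :=
  Matrix.of fun i j => ∏ k : {k : Fin d // k ≠ n}, A k (i k) (j k)

/-- The column-wise Khatri–Rao product of all matrices of a family but the `n`-th. -/
def coKhatriRao (n : Fin d) (A : ∀ k, Matrix (Fin (a k)) (Fin L) ℝ) :
    Matrix (CoIndex a n) (Fin L) ℝ :=
  Matrix.of fun i ℓ => ∏ k : {k : Fin d // k ≠ n}, A k (i k) ℓ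

theorem coProd_mul (n : Fin d) (A : ∀ k, Matrix (Fin (a k)) (Fin (b k)) ℝ)
    (B : ∀ k, Matrix (Fin (b k)) (Fin (c k)) ℝ) :
    coProd n A * coProd n B = coProd n fun k => A k * B k := by
  ext i j
  simp only [coProd, Matrix.mul_apply, Matrix.of_apply, ← Finset.prod_mul_distrib]
  exact (Fintype.prod_sum fun (k : {k : Fin d // k ≠ n}) q => A k (i k) q * B k q (j k)).symm

theorem coProd_mul_coKhatriRao (n : Fin d) (A : ∀ k, Matrix (Fin (a k)) (Fin (b k)) ℝ)
    (B : ∀ k, Matrix (Fin (b k)) (Fin L) ℝ) :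
    coProd n A * coKhatriRao n B = coKhatriRao n fun k => A k * B k := by
  ext i j
  simp only [coProd, coKhatriRao, Matrix.mul_apply, Matrix.of_apply, ← Finset.prod_mul_distrib]
  exact (Fintype.prod_sum fun (k : {k : Fin d // k ≠ n}) q => A k (i k) q * B k q j).symm

theorem coProd_one (n : Fin d) :
    coProd n (fun k => (1 : Matrix (Fin (a k)) (Fin (a k)) ℝ)) = 1 := by
  ext i j
  simp only [coProd, Matrix.of_apply, Matrix.one_apply, Finset.prod_ite_zero, Finset.prod_const_one,
    Finset.mem_univ, true_implies, funext_iff]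

theorem frobSq_coProd (n : Fin d) (A : ∀ k, Matrix (Fin (a k)) (Fin (b k)) ℝ) :
    frobSq (coProd n A) = ∏ k : {k : Fin d // k ≠ n}, frobSq (A k) := by
  simp only [frobSq, coProd, Matrix.of_apply, ← Finset.prod_pow]
  rw [Fintype.prod_sum]
  refine Finset.sum_congr rfl fun i _ => ?_
  exact (Fintype.prod_sum fun (k : {k : Fin d // k ≠ n}) q => A k (i k) q ^ 2).symm

theorem coSize_eq_prod (n : Fin d) : coSize a n = ∏ k : {k : Fin d // k ≠ n}, (a k : ℝ) :=
  Finset.prod_subtype _ (by simp) _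

theorem flatten_interactive_eq (n : Fin d) (Φ : ∀ n, Matrix (Fin (a n)) (Fin L) ℝ) :
    flatten n (interactive Φ) = Φ n * (coKhatriRao n Φ)ᵀ := by
  ext i j
  simp only [flatten, interactive, coKhatriRao, Matrix.mul_apply, Matrix.transpose_apply,
    Matrix.of_apply]
  refine Finset.sum_congr rfl fun ℓ _ => ?_
  rw [← Finset.mul_prod_erase _ _ (Finset.mem_univ n),
    Finset.prod_subtype (p := fun k => k ≠ n) (Finset.univ.erase n) (by simp)]
  congr 1
  · simp [Equiv.piSplitAt]
  · refine Finset.prod_congr rfl fun k _ => ?_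
    simp [Equiv.piSplitAt, k.2]

/-- The coefficients of the flattened interactive effect in the Kronecker products of factors. -/
def coreMatrix (n : Fin d) (B : ∀ k, Matrix (Fin (b k)) (Fin L) ℝ) :
    Matrix (Fin (b n)) (CoIndex b n) ℝ :=
  B n * (coKhatriRao n B)ᵀ

theorem flatten_interactive_mul (n : Fin d) (φ : ∀ k, Matrix (Fin (a k)) (Fin (b k)) ℝ)
    (B : ∀ k, Matrix (Fin (b k)) (Fin L) ℝ) :
    flatten n (interactive fun k => φ k * B k)
      = φ n * (coProd n φ * (coreMatrix n B)ᵀ)ᵀ := by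
  rw [flatten_interactive_eq, ← coProd_mul_coKhatriRao, coreMatrix]
  simp only [Matrix.transpose_mul, Matrix.transpose_transpose, Matrix.mul_assoc]

theorem exists_rightInv_coreMatrix (n : Fin d) (φ : ∀ k, Matrix (Fin (a k)) (Fin (b k)) ℝ)
    (B : ∀ k, Matrix (Fin (b k)) (Fin L) ℝ)
    (h : (flatten n (interactive fun k => φ k * B k)).rank = b n) :
    ∃ W : Matrix (CoIndex b n) (Fin (b n)) ℝ, coreMatrix n B * W = 1 := by
  rw [flatten_interactive_mul, Matrix.transpose_mul, Matrix.transpose_transpose] at h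
  have h1 : b n ≤ (coreMatrix n B).rank :=
    h.symm.le.trans ((Matrix.rank_mul_le_right _ _).trans (Matrix.rank_mul_le_left _ _))
  refine Matrix.mulVec_surjective_iff_exists_right_inverse.1 ?_
  have h2 : LinearMap.range (coreMatrix n B).mulVecLin = ⊤ := by
    refine Submodule.eq_top_of_finrank_eq (le_antisymm (Submodule.finrank_le _) ?_)
    rw [Module.finrank_fin_fun]
    exact h1
  exact LinearMap.range_eq_top.1 h2

theorem prod_le_pow_mul_coSize {n : Fin d} {M : ℝ} {x : Fin d → ℝ} (hx : ∀ k, 0 ≤ x k)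
    (h : ∀ k, x k ≤ M * a k) :
    ∏ k : {k : Fin d // k ≠ n}, x k ≤ M ^ Fintype.card {k : Fin d // k ≠ n} * coSize a n := by
  refine (Finset.prod_le_prod (f := fun k : {k : Fin d // k ≠ n} => x k) (fun k _ => hx k)
    fun k _ => h k).trans (le_of_eq ?_)
  rw [Finset.prod_mul_distrib, Finset.prod_const, Finset.card_univ, coSize_eq_prod]

theorem prod_le_pow_div_coSize {n : Fin d} {M : ℝ} {x : Fin d → ℝ} (hx : ∀ k, 0 ≤ x k)
    (h : ∀ k, x k ≤ M / a k) :
    ∏ k : {k : Fin d // k ≠ n}, x k ≤ M ^ Fintype.card {k : Fin d // k ≠ n} / coSize a n := by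
  refine (Finset.prod_le_prod (f := fun k : {k : Fin d // k ≠ n} => x k) (fun k _ => hx k)
    fun k _ => h k).trans (le_of_eq ?_)
  rw [Finset.prod_div_distrib, Finset.prod_const, Finset.card_univ, coSize_eq_prod]

end Interactive

/-! ### Tight families of events -/

section Likely

variable {ι : Type*} {l : Filter ι} {Ω : ι → Type*} [∀ m, MeasurableSpace (Ω m)]
  {P : ∀ m, Measure (Ω m)}

/-- The events `E M` have eventually probability close to one, provided that the bound `M` is
large. -/
def Likely (l : Filter ι) (P : ∀ m, Measure (Ω m)) (E : ℝ → ∀ m, Ω m → Prop) : Prop :=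
  ∀ η : ℝ≥0∞, 0 < η → ∃ M₀ : ℝ, ∀ M ≥ M₀, ∀ᶠ m in l, P m {ω | ¬ E M m ω} ≤ η

theorem Likely.and {E E' : ℝ → ∀ m, Ω m → Prop} (h : Likely l P E) (h' : Likely l P E') :
    Likely l P fun M m ω => E M m ω ∧ E' M m ω := by
  intro η hη
  have hη2 : 0 < η / 2 := ENNReal.half_pos hη.ne'
  obtain ⟨M₁, h₁⟩ := h _ hη2
  obtain ⟨M₂, h₂⟩ := h' _ hη2
  refine ⟨max M₁ M₂, fun M hM => ?_⟩
  filter_upwards [h₁ M ((le_max_left _ _).trans hM), h₂ M ((le_max_right _ _).trans hM)]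
    with m hm₁ hm₂
  calc P m {ω | ¬ (E M m ω ∧ E' M m ω)}
      ≤ P m ({ω | ¬ E M m ω} ∪ {ω | ¬ E' M m ω}) :=
        measure_mono fun ω hω => not_and_or.1 hω
    _ ≤ η / 2 + η / 2 := (measure_union_le _ _).trans (add_le_add hm₁ hm₂)
    _ = η := ENNReal.add_halves η

theorem Likely.mono {E E' : ℝ → ∀ m, Ω m → Prop} (h : Likely l P E)
    (hE : ∀ M, ∀ᶠ m in l, ∀ ω, E M m ω → E' M m ω) : Likely l P E' := by
  intro η hη
  obtain ⟨M₀, h₀⟩ := h η hη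
  refine ⟨M₀, fun M hM => ?_⟩
  filter_upwards [h₀ M hM, hE M] with m hm hm'
  exact (measure_mono fun ω (hω : ¬ E' M m ω) hE => hω (hm' ω hE)).trans hm

theorem likely_true : Likely l P fun _ _ _ => True :=
  fun η _ => ⟨0, fun _ _ => Eventually.of_forall fun m => by simp⟩

theorem likely_ge (c : ℝ) : Likely l P fun M _ _ => c ≤ M :=
  fun η _ => ⟨c, fun M hM => Eventually.of_forall fun m => by simp [hM.le]⟩

theorem Likely.forall_finite {κ : Type*} [Finite κ] {E : κ → ℝ → ∀ m, Ω m → Prop}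
    (h : ∀ k, Likely l P (E k)) : Likely l P fun M m ω => ∀ k, E k M m ω := by
  have := Fintype.ofFinite κ
  suffices H : ∀ s : Finset κ, Likely l P fun M m ω => ∀ k ∈ s, E k M m ω by
    simpa using H Finset.univ
  classical
  intro s
  induction s using Finset.induction_on with
  | empty => simpa using likely_true
  | insert k s _ ih => simpa only [Finset.forall_mem_insert] using (h k).and ih

theorem Wpa1.likely {E : ∀ m, Ω m → Prop} (h : Wpa1 l P E) : Likely l P fun _ => E :=
  fun η hη => ⟨0, fun _ _ => ENNReal.tendsto_nhds_zero.1 h η hη⟩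

theorem IsBigOp.likely {Z : ∀ m, Ω m → ℝ} {a : ι → ℝ} (h : IsBigOp l P Z a) (ha : ∀ m, 0 ≤ a m) :
    Likely l P fun M m ω => |Z m ω| ≤ M * a m := by
  intro η hη
  obtain ⟨M₀, h₀⟩ := h η hη
  refine ⟨M₀, fun M hM => h₀.mono fun m hm => (measure_mono fun ω hω => ?_).trans hm⟩
  exact (mul_le_mul_of_nonneg_right hM (ha m)).trans_lt (not_le.1 hω)

theorem proxyRate_of_rotationBound {n : ι → ℕ} {r k : ℕ}
    {F : ∀ m, Ω m → Matrix (Fin (n m)) (Fin k) ℝ} {φ : ∀ m, Ω m → Matrix (Fin (n m)) (Fin r) ℝ}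
    {a : ι → ℝ} (ha : ∀ m, 0 ≤ a m) {E : ℝ → ∀ m, Ω m → Prop} (hE : Likely l P E)
    (h : ∀ M, ∃ C, ∀ᶠ m in l, ∀ ω, E M m ω → RotationBound (F m ω) (φ m ω) (n m) (a m) C) :
    ProxyRate l P F φ a := by
  classical
  have h₁ : ∀ m ω, ∃ (H : Matrix (Fin r) (Fin k) ℝ) (G : Matrix (Fin k) (Fin r) ℝ), ∀ C : ℕ,
      RotationBound (F m ω) (φ m ω) (n m) (a m) C →
      frobSq H ≤ C ∧ frobSq G ≤ C ∧ H * G = 1 ∧ (n m : ℝ)⁻¹ * frobSq (F m ω - φ m ω * H) ≤ C * a m ∧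
      (n m : ℝ)⁻¹ * frobSq (F m ω * G - φ m ω) ≤ C * a m := by
    intro m ω
    by_cases hex : ∃ C : ℕ, RotationBound (F m ω) (φ m ω) (n m) (a m) C
    · obtain ⟨H, G, e1, e2, e3, e4, e5⟩ := Nat.find_spec hex
      refine ⟨H, G, fun C hC => ?_⟩
      have hle : ((Nat.find hex : ℕ) : ℝ) ≤ C := by exact_mod_cast Nat.find_min' hex hC
      have := mul_le_mul_of_nonneg_right hle (ha m)
      exact ⟨e1.trans hle, e2.trans hle, e3, e4.trans this, e5.trans this⟩
    · exact ⟨0, 0, fun C hC => absurd ⟨C, hC⟩ hex⟩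
  choose H G hHG using h₁
  have key : ∀ η : ℝ≥0∞, 0 < η → ∃ C : ℕ, ∀ᶠ m in l,
      P m {ω | ¬ RotationBound (F m ω) (φ m ω) (n m) (a m) C} ≤ η := by
    intro η hη
    obtain ⟨M, hM⟩ := hE η hη
    obtain ⟨C, hC⟩ := h M
    refine ⟨⌈C⌉₊, ?_⟩
    filter_upwards [hM M le_rfl, hC] with m hm hm'
    refine (measure_mono fun ω (hω : ¬ RotationBound _ _ _ _ _) hEω => ?_).trans hm
    exact hω ((hm' ω hEω).mono (ha m) (Nat.le_ceil C))
  have big : ∀ (Z : ∀ m, Ω m → ℝ) (b : ι → ℝ), (∀ m ω, 0 ≤ Z m ω) →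
      (∀ m ω (C : ℕ), RotationBound (F m ω) (φ m ω) (n m) (a m) C → Z m ω ≤ C * b m) →
      IsBigOp l P Z b := by
    intro Z b hZ hZb η hη
    obtain ⟨C, hC⟩ := key η hη
    refine ⟨C, hC.mono fun m hm => (measure_mono fun ω hω hR => ?_).trans hm⟩
    have hω' : C * b m < |Z m ω| := hω
    rw [abs_of_nonneg (hZ m ω)] at hω'
    exact absurd (hZb m ω C hR) (not_le.2 hω')
  have hn : ∀ m, 0 ≤ (n m : ℝ)⁻¹ := fun m => by positivity
  refine ⟨H, G, big _ _ (fun _ _ => frobSq_nonneg _) fun m ω C hR => ?_,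
    big _ _ (fun _ _ => frobSq_nonneg _) fun m ω C hR => ?_, ?_,
    big _ _ (fun m _ => mul_nonneg (hn m) (frobSq_nonneg _)) fun m ω C hR => (hHG m ω C hR).2.2.2.1,
    big _ _ (fun m _ => mul_nonneg (hn m) (frobSq_nonneg _)) fun m ω C hR => (hHG m ω C hR).2.2.2.2⟩
  · simpa using (hHG m ω C hR).1
  · simpa using (hHG m ω C hR).2.1
  · refine ENNReal.tendsto_nhds_zero.2 fun η hη => ?_
    obtain ⟨C, hC⟩ := key η hη
    exact hC.mono fun m hm => (measure_mono fun ω (hω : ¬ H m ω * G m ω = 1) hR =>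
      hω (hHG m ω C hR).2.2.1).trans hm

end Likely

section Gram

/-- Factors with a Gram matrix close to a positive definite one have a left inverse of the expected
size. -/
theorem exists_leftInv_of_gram {r : ℕ} {S : Matrix (Fin r) (Fin r) ℝ} (hS : S.PosDef) :
    ∃ c M : ℝ, 0 < c ∧ ∀ (n : ℕ) (φ : Matrix (Fin n) (Fin r) ℝ), 0 < n →
      (∀ a b, |(n : ℝ)⁻¹ * (φᵀ * φ) a b - S a b| < c) →
      ∃ ψ : Matrix (Fin r) (Fin n) ℝ, ψ * φ = 1 ∧ frobSq ψ ≤ M / n ∧ frobSq φ ≤ M * n := by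
  obtain ⟨S', hS'⟩ := hS.isUnit.exists_right_inv
  set f := frobSq S'
  have hf : 0 ≤ f := frobSq_nonneg _
  set c : ℝ := min 1 (1 / (4 * ((r : ℝ) * r * f + 1))) with hc
  have hc0 : 0 < c := by positivity
  set M₁ : ℝ := ∑ a, (|S a a| + 1)
  have hM₁ : 0 ≤ M₁ := Finset.sum_nonneg fun _ _ => by positivity
  refine ⟨c, M₁ + f * (4 * r) * M₁, hc0, fun n φ hn h => ?_⟩
  have hn' : (0 : ℝ) < n := by exact_mod_cast hn
  set T : Matrix (Fin r) (Fin r) ℝ := (n : ℝ)⁻¹ • (φᵀ * φ) with hT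
  have hD : frobSq ((S - T) * S') ≤ 1 / 4 := by
    have h1 : frobSq (S - T) ≤ r * r * c := by
      have h2 : frobSq (S - T) ≤ ∑ _a : Fin r, ∑ _b : Fin r, c := by
        refine Finset.sum_le_sum fun a _ => Finset.sum_le_sum fun b _ => ?_
        have h3 := (h a b).le
        have h4 : (S - T) a b ^ 2 = |(n : ℝ)⁻¹ * (φᵀ * φ) a b - S a b| ^ 2 := by
          rw [sq_abs, hT, Matrix.sub_apply, Matrix.smul_apply, smul_eq_mul]
          ring
        rw [h4]
        calc |(n : ℝ)⁻¹ * (φᵀ * φ) a b - S a b| ^ 2 ≤ c ^ 2 :=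
              pow_le_pow_left₀ (abs_nonneg _) h3 2
          _ ≤ c := by nlinarith [min_le_left (1 : ℝ) (1 / (4 * ((r : ℝ) * r * f + 1)))]
      simpa [mul_assoc] using h2
    have h5 : c ≤ 1 / (4 * ((r : ℝ) * r * f + 1)) := min_le_right _ _
    rw [le_div_iff₀ (by positivity)] at h5
    refine (frobSq_mul_le _ _).trans ((mul_le_mul_of_nonneg_right h1 hf).trans ?_)
    linarith
  obtain ⟨J, hJ, hJr⟩ := exists_inv_one_sub _ hD
  have hTJ : S' * J * T = 1 := by
    refine mul_eq_one_comm.1 ?_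
    rw [← hJ, Matrix.sub_mul S, hS', sub_sub_cancel, Matrix.mul_assoc]
  have hφ : frobSq φ ≤ M₁ * n := by
    have h1 : frobSq φ = n * ∑ a, (n : ℝ)⁻¹ * (φᵀ * φ) a a := by
      rw [frobSq_eq_trace, ← Finset.mul_sum, mul_inv_cancel_left₀ hn'.ne', Matrix.trace]
      rfl
    rw [h1, mul_comm]
    refine mul_le_mul_of_nonneg_right (Finset.sum_le_sum fun a _ => ?_) hn'.le
    have h2 := (abs_lt.1 (h a a)).2
    linarith [le_abs_self (S a a), min_le_left (1 : ℝ) (1 / (4 * ((r : ℝ) * r * f + 1)))]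
  have hM₂ : 0 ≤ f * (4 * r) * M₁ := by positivity
  refine ⟨(n : ℝ)⁻¹ • (S' * J * φᵀ), ?_, ?_, ?_⟩
  · rw [← hTJ, hT, Matrix.smul_mul, Matrix.mul_smul, Matrix.mul_assoc _ φᵀ]
  · rw [frobSq_smul]
    have h1 : frobSq (S' * J * φᵀ) ≤ f * (4 * r) * (M₁ * n) := by
      refine (frobSq_mul_le _ _).trans (mul_le_mul ?_ ?_ (frobSq_nonneg _) (by positivity))
      · exact (frobSq_mul_le _ _).trans (mul_le_mul_of_nonneg_left hJr hf)
      · rwa [frobSq_transpose]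
    calc (n : ℝ)⁻¹ ^ 2 * frobSq (S' * J * φᵀ) ≤ (n : ℝ)⁻¹ ^ 2 * (f * (4 * r) * (M₁ * n)) := by
          gcongr
      _ = f * (4 * r) * M₁ / n := by field_simp
      _ ≤ _ := by
          gcongr
          linarith
  · refine hφ.trans (mul_le_mul_of_nonneg_right ?_ hn'.le)
    linarith

end Gram

/-! ### The rate of the proxies -/

section Sample

variable {d K L : ℕ}

theorem RotationBound.unitProxy {N : Fin d → ℕ} {n : Fin d} {r k : ℕ} (hkr : k = r) {a C M : ℝ}
    (hn : 0 < N n) (ha : 0 ≤ a) (ha1 : a ≤ 1) (hM : 0 ≤ M) {U : Matrix (Fin (N n)) (Fin k) ℝ}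
    {s : Fin k → ℝ} {φ : Matrix (Fin (N n)) (Fin r) ℝ} {ψ : Matrix (Fin r) (Fin (N n)) ℝ}
    (hψφ : ψ * φ = 1) (hψ : frobSq ψ ≤ M / N n) (hφ : frobSq φ ≤ M * N n) (hU : Uᵀ * U = 1)
    (h : RotationBound (scoreProxy n U s) φ (N n) a C) (hsmall : M * C * a ≤ 1 / 4) :
    RotationBound (unitProxy n U) φ (N n) a (unitConst C M r) := by
  subst hkr
  have hn' : (0 : ℝ) < N n := by exact_mod_cast hn
  refine RotationBound.unit hn' ha ha1 hM
    (T := ((Real.sqrt (N n))⁻¹ * (Real.sqrt (coSize N n))⁻¹) • Matrix.diagonal s)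
    hψφ hψ hφ hU ?_ hsmall
  rw [Matrix.mul_smul, smul_smul, mul_inv_cancel_left₀ (Real.sqrt_pos.2 hn').ne']
  exact h

/-- The event that one sample satisfies the assumptions with constants `M` and `c`. -/
structure GoodSample {N : Fin d → ℕ} {r rhat : Fin d → ℕ} (n : Fin d) (c M : ℝ)
    (β : Fin K → ℝ) (φ : ∀ n, Matrix (Fin (N n)) (Fin (r n)) ℝ)
    (B : ∀ n, Matrix (Fin (r n)) (Fin L) ℝ) (X : Fin K → Tensor N) (ε : Tensor N)
    (b : Fin K → ℝ) (U : Matrix (Fin (N n)) (Fin (rhat n)) ℝ) (s : Fin (rhat n) → ℝ) : Prop where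
  one_le : 1 ≤ M
  leftInv : ∀ k, ∃ ψ : Matrix (Fin (r k)) (Fin (N k)) ℝ, ψ * φ k = 1 ∧ frobSq ψ ≤ M / N k ∧
    frobSq (φ k) ≤ M * N k
  norm_X : ∀ k, |Real.sqrt (∑ i, X k i ^ 2)| ≤ M * Real.sqrt (total N)
  norm_ε : |specNorm (flatten n ε)| ≤ M * max (Real.sqrt (N n)) (Real.sqrt (coSize N n))
  exog : ∀ k, |∑ i, X k i * ε i| ≤ M * Real.sqrt (total N)
  nonsing : ∀ δ : Fin K → ℝ, ∑ k, δ k ^ 2 = 1 →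
    c < ∑ s ∈ Finset.Ico (r n + rhat n) (min (N n) (Fintype.card (CoIndex N n))),
      singVal ((Real.sqrt (total N))⁻¹ • flatten n (lin X δ)) s ^ 2
  est : IsLSEstimate n (rhat n) (outcome X β (fun n' => φ n' * B n') ε) X b U s

/-- The constant bounding all quantities of a good sample. -/
noncomputable def sampleConst (K g : ℕ) (κ c M q : ℝ) : ℝ :=
  M + M ^ g * q + |2 * M ^ 2 + 2 * (K * M ^ 2 * slopeConst K κ (M ^ 2) c)|

theorem GoodSample.rotationBound {N : Fin d → ℕ} {r rhat : Fin d → ℕ} {n : Fin d} {c M : ℝ}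
    {β : Fin K → ℝ} {φ : ∀ n, Matrix (Fin (N n)) (Fin (r n)) ℝ}
    {B : ∀ n, Matrix (Fin (r n)) (Fin L) ℝ} {X : Fin K → Tensor N} {ε : Tensor N}
    {b : Fin K → ℝ} {U : Matrix (Fin (N n)) (Fin (rhat n)) ℝ} {s : Fin (rhat n) → ℝ}
    (h : GoodSample n c M β φ B X ε b U s) (hc : 0 < c) (hrk : r n ≤ rhat n)
    (hN : ∀ k, 0 < N k) {W : Matrix (CoIndex r n) (Fin (r n)) ℝ} (hW : coreMatrix n B * W = 1)
    {D : ℝ} (hD : D = sampleConst K (Fintype.card {k : Fin d // k ≠ n}) (r n + rhat n) c M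
      (frobSq (coreMatrix n B) + frobSq W))
    (hlarge : 16 * D ^ 3 + 4 * D * scoreConst D (r n) (rhat n) + 1
      ≤ min (N n : ℝ) (coSize N n)) :
    RotationBound (scoreProxy n U s) (φ n) (N n) (1 / min (N n : ℝ) (coSize N n))
        (scoreConst D (r n) (rhat n)) ∧
      (rhat n = r n → RotationBound (unitProxy n U) (φ n) (N n)
        (1 / min (N n : ℝ) (coSize N n)) (unitConst (scoreConst D (r n) (rhat n)) D (r n))) := by
  have hM1 := h.one_le
  have hM0 : 0 ≤ M := zero_le_one.trans hM1
  have hn₁ : (1 : ℝ) ≤ N n := by exact_mod_cast hN n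
  have hn₁' : (0 : ℝ) < N n := by linarith
  have hn₂ : 0 < coSize N n := Finset.prod_pos fun k _ => by exact_mod_cast hN k
  have hT : 0 < total N := Finset.prod_pos fun k _ => by exact_mod_cast hN k
  set v := max (N n : ℝ) (coSize N n) with hv
  have hv1 : 1 ≤ v := hn₁.trans (le_max_left _ _)
  set q := frobSq (coreMatrix n B) + frobSq W with hq
  set g := Fintype.card {k : Fin d // k ≠ n}
  set A := 2 * M ^ 2 + 2 * (K * M ^ 2 * slopeConst K (r n + rhat n) (M ^ 2) c) with hAdef
  have hgM : 0 ≤ M ^ g := pow_nonneg hM0 g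
  have hQ0 := frobSq_nonneg (coreMatrix n B)
  have hW0 := frobSq_nonneg W
  have hD' : D = M + M ^ g * q + |A| := hD
  have hMD : M ≤ D := by rw [hD']; nlinarith [abs_nonneg A, mul_nonneg hgM (add_nonneg hQ0 hW0)]
  have hqD : M ^ g * q ≤ D := by rw [hD']; linarith [abs_nonneg A]
  have hAD : A ≤ D := by
    rw [hD']; nlinarith [le_abs_self A, mul_nonneg hgM (add_nonneg hQ0 hW0)]
  have hD0 : 0 ≤ D := hM0.trans hMD
  have hC0 : 0 ≤ scoreConst D (r n) (rhat n) := by unfold scoreConst; positivity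
  choose ψ hψφ hψ hφ using h.leftInv
  set Γ := coProd n φ * (coreMatrix n B)ᵀ with hΓ
  have hflat := flatten_interactive_mul n φ B
  have hX : ∀ k, ∑ i, X k i ^ 2 ≤ M ^ 2 * total N := fun k => by
    have h1 := pow_le_pow_left₀ (abs_nonneg _) (h.norm_X k) 2
    rwa [sq_abs, mul_pow, Real.sq_sqrt hT.le,
      Real.sq_sqrt (Finset.sum_nonneg fun _ _ => sq_nonneg _)] at h1
  have hXε : ∀ k, (∑ i, X k i * ε i) ^ 2 ≤ M ^ 2 * total N := fun k => by
    have h1 := pow_le_pow_left₀ (abs_nonneg _) (h.exog k) 2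
    rwa [sq_abs, mul_pow, Real.sq_sqrt hT.le] at h1
  have hε : OpBound (flatten n ε) (M ^ 2 * v) := by
    refine (opBound_specNorm _).mono ?_
    have h1 := pow_le_pow_left₀ (abs_nonneg _) h.norm_ε 2
    rw [sq_abs, mul_pow, 
      ← Monotone.map_max (f := Real.sqrt) fun _ _ => Real.sqrt_le_sqrt,
      Real.sq_sqrt (zero_le_one.trans hv1)] at h1
    exact h1
  have hslope := slope_sq_le (sq_nonneg M) hT hv1 hc hrk hflat hX hXε hε h.nonsing
    (h.est.slope β)
  have hE := (opBound_residual (sq_nonneg M) hflat hX hε hslope).mono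
    (mul_le_mul_of_nonneg_right hAD (zero_le_one.trans hv1))
  have hΓZ : Γᵀ * ((coProd n ψ)ᵀ * W) = 1 := by
    have e : coProd n ψ * coProd n φ = 1 := by
      rw [coProd_mul, ← coProd_one]
      exact congrArg _ (funext hψφ)
    rw [hΓ, Matrix.transpose_mul, Matrix.transpose_transpose, Matrix.mul_assoc,
      ← Matrix.mul_assoc _ _ W, ← Matrix.transpose_mul, e, Matrix.transpose_one, Matrix.one_mul, hW]
  have hΓle : frobSq Γ ≤ D * coSize N n := by
    refine (frobSq_mul_le _ _).trans ?_
    rw [frobSq_coProd, frobSq_transpose]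
    refine (mul_le_mul_of_nonneg_right
      (prod_le_pow_mul_coSize (fun k => frobSq_nonneg (φ k)) hφ) hQ0).trans ?_
    refine le_trans (le_of_eq ?_) (mul_le_mul_of_nonneg_right
      (hqD.trans' (mul_le_mul_of_nonneg_left (le_add_of_nonneg_right hW0) hgM)) hn₂.le)
    ring
  have hZle : frobSq ((coProd n ψ)ᵀ * W) ≤ D / coSize N n := by
    refine (frobSq_mul_le _ _).trans ?_
    rw [frobSq_transpose, frobSq_coProd]
    refine (mul_le_mul_of_nonneg_right
      (prod_le_pow_div_coSize (fun k => frobSq_nonneg (ψ k)) hψ) hW0).trans ?_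
    rw [div_mul_eq_mul_div]
    refine div_le_div_of_nonneg_right ?_ hn₂.le
    exact hqD.trans' (mul_le_mul_of_nonneg_left (le_add_of_nonneg_left hQ0) hgM)
  have hψD : frobSq (ψ n) ≤ D / N n := (hψ n).trans (div_le_div_of_nonneg_right hMD hn₁'.le)
  have hDC : 0 ≤ 4 * D * scoreConst D (r n) (rhat n) := by positivity
  have hD3 : 0 ≤ 16 * D ^ 3 := by positivity
  have hmin : 0 < min (N n : ℝ) (coSize N n) := lt_min hn₁' hn₂
  have hscore : RotationBound (scoreProxy n U s) (φ n) (N n) (1 / min (N n : ℝ) (coSize N n))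
      (scoreConst D (r n) (rhat n)) :=
    rotationBound_score hrk hn₁' hn₂ hD0 (hψφ n) hΓZ hψD hΓle hZle hE h.est.leading (by linarith)
  refine ⟨hscore, fun hkr => ?_⟩
  have hU : Uᵀ * U = 1 :=
    (h.est.leading.exists_right hrk (mul_nonneg hD0 (zero_le_one.trans hv1)) hE).1
  refine hscore.unitProxy hkr (hN n) (by positivity) ?_ hD0 (hψφ n) hψD
    ((hφ n).trans (mul_le_mul_of_nonneg_right hMD hn₁'.le)) hU ?_
  · rw [div_le_one hmin]
    linarith
  · rw [mul_one_div, div_le_iff₀ hmin]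
    linarith

end Sample

theorem tendsto_coSize {ι : Type*} {l : Filter ι} {d : ℕ} (hd : 2 ≤ d) {N : ι → Fin d → ℕ}
    (hN : ∀ n, Tendsto (fun m => N m n) l atTop) (n : Fin d) :
    Tendsto (fun m => coSize (N m) n) l atTop := by
  have : Nontrivial (Fin d) := Fin.nontrivial_iff_two_le.2 hd
  obtain ⟨k, hk⟩ := exists_ne n
  refine tendsto_atTop_mono' l ?_ (tendsto_natCast_atTop_atTop.comp (hN k))
  filter_upwards [eventually_all.2 fun n => (hN n).eventually_ge_atTop 1] with m hm
  have h1 : N m k ≤ ∏ j ∈ Finset.univ.erase n, N m j :=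
    Nat.le_of_dvd (Finset.prod_pos fun j _ => hm j)
      (Finset.dvd_prod_of_mem _ (Finset.mem_erase.2 ⟨hk, Finset.mem_univ _⟩))
  rw [coSize, Function.comp_apply]
  exact_mod_cast h1

theorem MomentConditions.likely_leftInv {ι : Type*} {l : Filter ι} {Ω : ι → Type*}
    [∀ m, MeasurableSpace (Ω m)] {P : ∀ m, Measure (Ω m)} {d K : ℕ} {N : ι → Fin d → ℕ}
    (hN : ∀ n, Tendsto (fun m => N m n) l atTop) {r : Fin d → ℕ}
    {φ : ∀ m, Ω m → ∀ n, Matrix (Fin (N m n)) (Fin (r n)) ℝ}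
    {X : ∀ m, Ω m → Fin K → Tensor (N m)} {ε : ∀ m, Ω m → Tensor (N m)}
    (h : MomentConditions l P N r φ X ε) :
    Likely l P fun M m ω => ∀ k, ∃ ψ : Matrix (Fin (r k)) (Fin (N m k)) ℝ, ψ * φ m ω k = 1 ∧
      frobSq ψ ≤ M / N m k ∧ frobSq (φ m ω k) ≤ M * N m k := by
  refine Likely.forall_finite fun k => ?_
  obtain ⟨S, hS, hlim⟩ := h.gram_φ k
  obtain ⟨c, M₀, hc, hψ⟩ := exists_leftInv_of_gram hS
  refine ((likely_ge M₀).and (Likely.forall_finite fun a => Likely.forall_finite fun b =>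
    (hlim a b c hc).likely)).mono fun M => ?_
  filter_upwards [(hN k).eventually_ge_atTop 1] with m hm ω ⟨hM, hω⟩
  obtain ⟨ψ, h1, h2, h3⟩ := hψ _ _ hm hω
  exact ⟨ψ, h1, h2.trans (div_le_div_of_nonneg_right hM (Nat.cast_nonneg _)),
    h3.trans (mul_le_mul_of_nonneg_right hM (Nat.cast_nonneg _))⟩

end TensorPanel

theorem mainTheorem3 {ι : Type*} (l : Filter ι) {Ω : ι → Type*} [∀ m, MeasurableSpace (Ω m)]
    (P : ∀ m, Measure (Ω m)) [∀ m, IsProbabilityMeasure (P m)]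
    {d K L : ℕ} (hd : 2 ≤ d)
    (N : ι → Fin d → ℕ) (hN : ∀ n, Tendsto (fun m => N m n) l atTop)
    (r rhat : Fin d → ℕ) (hr : ∀ n, r n ≤ rhat n)
    (β : Fin K → ℝ)
    (φ : ∀ m, Ω m → ∀ n, Matrix (Fin (N m n)) (Fin (r n)) ℝ)
    (B : ∀ n, Matrix (Fin (r n)) (Fin L) ℝ)
    (X : ∀ m, Ω m → Fin K → TensorPanel.Tensor (N m))
    (ε : ∀ m, Ω m → TensorPanel.Tensor (N m))
    (hmom : TensorPanel.MomentConditions l P N r φ X ε)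
    (hflat : TensorPanel.FlatteningConditions l P N r rhat (fun m ω n => φ m ω n * B n) X ε)
    (βhat : ∀ m, Ω m → Fin d → Fin K → ℝ)
    (U : ∀ m, Ω m → ∀ n, Matrix (Fin (N m n)) (Fin (rhat n)) ℝ)
    (s : ∀ m, Ω m → ∀ n, Fin (rhat n) → ℝ)
    (hest : ∀ n, TensorPanel.Wpa1 l P fun m ω =>
      TensorPanel.IsLSEstimate n (rhat n)
        (TensorPanel.outcome (X m ω) β (fun n' => φ m ω n' * B n') (ε m ω)) (X m ω)
        (βhat m ω n) (U m ω n) (s m ω n)) :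
    ∀ n : Fin d,
      TensorPanel.ProxyRate l P
        (fun m ω => TensorPanel.scoreProxy n (U m ω n) (s m ω n)) (fun m ω => φ m ω n)
        (fun m => 1 / min (N m n : ℝ) (TensorPanel.coSize (N m) n)) ∧
      (rhat n = r n →
        TensorPanel.ProxyRate l P
          (fun m ω => TensorPanel.unitProxy n (U m ω n)) (fun m ω => φ m ω n)
          (fun m => 1 / min (N m n : ℝ) (TensorPanel.coSize (N m) n))) := by
  intro n
  rcases l.eq_or_neBot with rfl | hl
  · refine ⟨⟨fun _ _ => 0, fun _ _ => 0, ?_⟩, fun _ => ⟨fun _ _ => 0, fun _ _ => 0, ?_⟩⟩ <;>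
      simp [TensorPanel.IsBigOp, TensorPanel.Wpa1]
  obtain ⟨c, hc, hns⟩ := hflat.nonsing n
  obtain ⟨m₀, ω₀, hrank⟩ : ∃ m ω, (TensorPanel.flatten n
      (TensorPanel.interactive fun k => φ m ω k * B k)).rank = r n := by
    have h1 := (hflat.rank_eq n).eventually (gt_mem_nhds zero_lt_one)
    obtain ⟨m, hm⟩ := h1.exists
    by_contra! hne
    have : {ω | ¬ (TensorPanel.flatten n
        (TensorPanel.interactive fun k => φ m ω k * B k)).rank = r n} = Set.univ :=
      Set.eq_univ_of_forall fun ω => hne m ω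
    rw [this, measure_univ] at hm
    exact lt_irrefl _ hm
  obtain ⟨W, hW⟩ := TensorPanel.exists_rightInv_coreMatrix n _ B hrank
  have hsqrt : ∀ m, 0 ≤ Real.sqrt (TensorPanel.total (N m)) := fun _ => Real.sqrt_nonneg _
  have hgood : TensorPanel.Likely l P fun M m ω => TensorPanel.GoodSample n c M β (φ m ω) B
      (X m ω) (ε m ω) (βhat m ω n) (U m ω n) (s m ω n) := by
    refine ((TensorPanel.likely_ge 1).and ((hmom.likely_leftInv hN).and
      ((TensorPanel.Likely.forall_finite fun k => (hflat.norm_X k).likely hsqrt).and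
      (((hflat.norm_ε n).likely fun m => le_max_of_le_left (Real.sqrt_nonneg _)).and
      ((TensorPanel.Likely.forall_finite fun k => (hflat.exog k).likely hsqrt).and
      (hns.likely.and (hest n).likely)))))).mono fun M => Eventually.of_forall fun m ω hω => ?_
    obtain ⟨h1, h2, h3, h4, h5, h6, h7⟩ := hω
    exact ⟨h1, h2, h3, h4, h5, h6, h7⟩
  have hmin : Tendsto (fun m => min (N m n : ℝ) (TensorPanel.coSize (N m) n)) l atTop :=
    tendsto_atTop.2 fun x => by
      filter_upwards [(tendsto_natCast_atTop_atTop.comp (hN n)).eventually_ge_atTop x,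
        (TensorPanel.tendsto_coSize hd hN n).eventually_ge_atTop x] with m h1 h2
      exact le_min h1 h2
  have ha : ∀ m, 0 ≤ 1 / min (N m n : ℝ) (TensorPanel.coSize (N m) n) := fun m =>
    one_div_nonneg.2 (le_min (Nat.cast_nonneg _)
      (Finset.prod_nonneg fun _ _ => Nat.cast_nonneg _))
  have hpos : ∀ᶠ m in l, ∀ k, 0 < N m k :=
    eventually_all.2 fun k => (hN k).eventually_ge_atTop 1
  let D : ℝ → ℝ := fun M => TensorPanel.sampleConst K (Fintype.card {k : Fin d // k ≠ n})
    (r n + rhat n) c M (TensorPanel.frobSq (TensorPanel.coreMatrix n B) + TensorPanel.frobSq W)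
  have hlarge := fun M => hmin.eventually_ge_atTop
    (16 * D M ^ 3 + 4 * D M * TensorPanel.scoreConst (D M) (r n) (rhat n) + 1)
  refine ⟨TensorPanel.proxyRate_of_rotationBound ha hgood fun M => ?_,
    fun hkr => TensorPanel.proxyRate_of_rotationBound ha hgood fun M => ?_⟩
  · refine ⟨TensorPanel.scoreConst (D M) (r n) (rhat n), ?_⟩
    filter_upwards [hpos, hlarge M] with m hm hm' ω hω
    exact (hω.rotationBound hc (hr n) hm hW rfl hm').1
  · refine ⟨TensorPanel.unitConst (TensorPanel.scoreConst (D M) (r n) (rhat n)) (D M) (r n), ?_⟩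
    filter_upwards [hpos, hlarge M] with m hm hm' ω hω
    exact (hω.rotationBound hc (hr n) hm hW rfl hm').2 hkr
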